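/- Let $p\ge 1$, $T>0$, $d\in\mathbb N$, and let $A=\{0,1,\dots,d\}$ be the alphabet whose words index the coordinates of the extended tensor algebra $T((\mathbb R^{d+1}))=\prod_{k\ge 0}(\mathbb R^{d+1})^{\otimes k}$ (the letter $0$ stands for time). A $p$-rough path over $[0,T]$ is a continuous multiplicative functional $\mathbf X=(1,X^1,\dots,X^{\lfloor p\rfloor})$ on $\{0\le s\le t\le T\}$ (that is, it satisfies Chen's identity $\mathbf X_{s,t}=\mathbf X_{s,u}\otimes\mathbf X_{u,t}$ in the truncated tensor algebra) such that $X^i$ has finite $p/i$-variation for $1\le i\le\lfloor p\rfloor$. Its signature $\mathbf X^{\le\infty}$ is its unique continuous multiplicative extension to $T((\mathbb R^{d+1}))$ all of whose levels $i\ge1$ have finite $p/i$-variation, and $\mathbf X^{\le\infty}_T:=\mathbf X^{\le\infty}_{0,T}$. The $p$-variation distance is $$d_p(\mathbf X,\mathbf Y)=\max_{1\le i\le\lfloor p\rfloor}\ \sup_{(t_k)}\Big(\sum_k |X^i_{t_k,t_{k+1}}-Y^i_{t_k,t_{k+1}}|^{p/i}\Big)^{i/p},$$ the supremum being over finite partitions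 of $[0,T]$. A $p$-rough path is geometric if it is a limit in $d_p$ of $1$-rough paths (lifted to degree $\lfloor p\rfloor$ by their signatures). Let $\hat V^p$ be the space, with the topology of $d_p$, of geometric $p$-rough paths $\hat{\mathbf X}^{\le p}$ in $\mathbb R^{d+1}$ that lie over a time-extended path $\hat X_t=(t,X_t)$, i.e. $\langle \mathbf 0,\hat{\mathbf X}_{s,t}\rangle=t-s$. Let $F:\hat V^p\to\mathbb R$ be continuous, and suppose that there are weighted words $\pi_1,\dots,\pi_n$ (finite real linear combinations of words over $A$) and a continuous $f:\mathbb R^n\to\mathbb R$ such that $$F(\hat{\mathbf X}^{\le p})=f\big(\langle\pi_1,\hat{\mathbf X}^{\le\infty}_T\rangle,\dots,\langle\pi_n,\hat{\mathbf X}^{\le\infty}_T\rangle\big)\qquad\text{for all }\hat{\mathbf X}^{\le p}\in\hat V^p .$$ For $m\in\mathbb N^n$ let $\phi_m=\pi_1^{\star m_1}\star\cdots\star\pi_n^{\star m_n}$ be the shuffle monomial, where $\star$ is the shuffle product (the sum, with multiplicity, of all order-preserving interleavings of two words, extended bilinearly), and the zeroth power and the empty product are the empty word. Then: 1. For all $m\in\mathbb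 N^n$ and all $\hat{\mathbf X}^{\le p}\in\hat V^p$, $\ \prod_{i=1}^n\langle\pi_i,\hat{\mathbf X}^{\le\infty}_T\rangle^{m_i}=\langle\phi_m,\hat{\mathbf X}^{\le\infty}_T\rangle .$ 2. For every $\varepsilon>0$ and every compact set $\mathcal K\subset\hat V^p$ there are a finite set $\mathcal N\subset\mathbb N^n$ and real numbers $(\alpha_m)_{m\in\mathcal N}$ such that $$\Big|F(\hat{\mathbf X}^{\le p})-\sum_{m\in\mathcal N}\alpha_m\langle\phi_m,\hat{\mathbf X}^{\le\infty}_T\rangle\Big|<\varepsilon\qquad\text{for all }\hat{\mathbf X}^{\le p}\in\mathcal K .$$ -/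

import Mathlib

open Filter Topology
open scoped ENNReal

namespace RoughSig

/-! ### Words, weighted words and the shuffle product -/

/-- Weighted words `∑ α_w w` (finite real combinations of words over the alphabet `A`), i.e. the
elements of `ℝ⟨A⟩ ≃ T(ℝ^A)`. A word is a list of letters; the empty word is `[]`. -/
abbrev WeightedWord (A : Type) : Type := List A →₀ ℝ

/-- The list, with multiplicity, of all interleavings of two words that preserve the order of the
letters of each of them. -/
def shuffles {A : Type} : List A → List A → List (List A)
  | [], v => [v]
  | a :: u, [] => [a :: u]
  | a :: u, b :: v =>
      (shuffles u (b :: v)).map (List.cons a) ++ (shuffles (a :: u) v).map (List.cons b)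
  termination_by u v => u.length + v.length

/-- The shuffle product of two words, as a weighted word. -/
noncomputable def shuffleWord {A : Type} (u v : List A) : WeightedWord A :=
  ((shuffles u v).map fun w => Finsupp.single w (1 : ℝ)).sum

/-- The shuffle product of weighted words: the bilinear extension of `shuffleWord`. -/
noncomputable def shuffle {A : Type} (π ρ : WeightedWord A) : WeightedWord A :=
  π.sum fun u a => ρ.sum fun v b => (a * b) • shuffleWord u v

/-- Shuffle powers: `π^0 = ∅` and `π^(k+1) = π^k ⧢ π`. -/
noncomputable def shufflePow {A : Type} (π : WeightedWord A) : ℕ → WeightedWord A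
  | 0 => Finsupp.single [] 1
  | k + 1 => shuffle (shufflePow π k) π

/-- The shuffle monomial `φ_m = π_1^{m_1} ⧢ ⋯ ⧢ π_n^{m_n}` (all powers are shuffle powers). -/
noncomputable def shuffleMonomial {A : Type} {n : ℕ} (π : Fin n → WeightedWord A)
    (m : Fin n → ℕ) : WeightedWord A :=
  (List.ofFn fun i => shufflePow (π i) (m i)).foldr shuffle (Finsupp.single [] 1)

/-! ### The extended tensor algebra -/

/-- The extended tensor algebra `T((ℝ^A)) = ∏ₙ (ℝ^A)^{⊗ n}` in the basis of words: an element is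
given by its coordinates `⟨w, x⟩`, `w` a word. -/
abbrev TensorSeries (A : Type) : Type := List A → ℝ

/-- The tensor product on `T((ℝ^A))`: `⟨w, x ⊗ y⟩` is the sum of `⟨u, x⟩ ⟨v, y⟩` over all
factorizations `w = u v`. -/
def tensorMul {A : Type} (x y : TensorSeries A) : TensorSeries A :=
  fun w => ∑ k ∈ Finset.range (w.length + 1), x (w.take k) * y (w.drop k)

/-- The component `x_i ∈ (ℝ^A)^{⊗ i}` of `x`, in the Hilbert space with orthonormal basis the words
of length `i`. -/
noncomputable def level {A : Type} (x : TensorSeries A) (i : ℕ) : EuclideanSpace ℝ (Fin i → A) :=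
  WithLp.toLp 2 fun v => x (List.ofFn v)

/-- The dual pairing `⟨π, x⟩` between weighted words and the extended tensor algebra. -/
noncomputable def pairing {A : Type} (π : WeightedWord A) (x : TensorSeries A) : ℝ :=
  π.sum fun w a => a * x w

/-! ### Multiplicative functionals and p-variation -/

/-- The simplex `{(s, t) | 0 ≤ s ≤ t ≤ T}`. -/
abbrev Simplex (T : ℝ) : Type := {z : ℝ × ℝ // 0 ≤ z.1 ∧ z.1 ≤ z.2 ∧ z.2 ≤ T}

/-- A finite increasing sequence `pt 0 ≤ pt 1 ≤ ⋯ ≤ pt n` of points of `[0, T]` (the values of `pt`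
beyond `n` are never used). -/
structure Partition (T : ℝ) where
  n : ℕ
  pt : ℕ → ℝ
  mono : Monotone pt
  mem : ∀ k, pt k ∈ Set.Icc 0 T

/-- The `k`-th pair `(pt k, pt (k+1))` of a partition, a point of the simplex. -/
def Partition.pair {T : ℝ} (P : Partition T) (k : ℕ) : Simplex T :=
  ⟨(P.pt k, P.pt (k + 1)), (P.mem k).1, P.mono (Nat.le_succ k), (P.mem (k + 1)).2⟩

/-- `sup_P ∑_{t_k ∈ P} |Z_{t_k, t_{k+1}}|^q`. -/
noncomputable def variation {T : ℝ} {E : Type} [NormedAddCommGroup E] (q : ℝ)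
    (Z : Simplex T → E) : ℝ≥0∞ :=
  ⨆ P : Partition T, ∑ k ∈ Finset.range P.n, ‖Z (P.pair k)‖ₑ ^ q

/-- A (continuous) multiplicative functional of degree `N ≤ ∞` on the simplex: a map with values in
the truncated tensor algebra `T^N` (in `T((ℝ^A))` if `N = ∞`), with scalar component `1`, which
satisfies Chen's identity. -/
@[ext]
structure MultiplicativeFunctional (A : Type) (T : ℝ) (N : ℕ∞) where
  toFun : Simplex T → TensorSeries A
  trunc : ∀ z w, N < (w.length : ℕ∞) → toFun z w = 0
  scalar : ∀ z, toFun z [] = 1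
  cont : ∀ w, Continuous fun z => toFun z w
  chen : ∀ (s u t : ℝ) (hs : 0 ≤ s) (hsu : s ≤ u) (hut : u ≤ t) (ht : t ≤ T) (w : List A),
    (w.length : ℕ∞) ≤ N →
    toFun ⟨(s, t), hs, hsu.trans hut, ht⟩ w =
      tensorMul (toFun ⟨(s, u), hs, hsu, hut.trans ht⟩)
        (toFun ⟨(u, t), hs.trans hsu, hut, ht⟩) w

/-- Finite `p`-variation: the component of level `i` has finite `p/i`-variation for every
`1 ≤ i ≤ N`. -/
def MultiplicativeFunctional.FinitePVar {A : Type} [Fintype A] {T : ℝ} {N : ℕ∞}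
    (X : MultiplicativeFunctional A T N) (p : ℝ) : Prop :=
  ∀ i : ℕ, 1 ≤ i → (i : ℕ∞) ≤ N → variation (p / i) (fun z => level (X.toFun z) i) < ⊤

/-- A `p`-rough path in `ℝ^A` over `[0, T]`: a multiplicative functional of degree `⌊p⌋` of finite
`p`-variation. -/
@[ext]
structure RoughPath (A : Type) [Fintype A] (p T : ℝ)
    extends MultiplicativeFunctional A T (⌊p⌋₊ : ℕ∞) where
  finitePVar : toMultiplicativeFunctional.FinitePVar p

/-- The `p`-variation distance
`max_{1 ≤ i ≤ ⌊p⌋} sup_P (∑_{t_k ∈ P} |X^i_{t_k,t_{k+1}} - Y^i_{t_k,t_{k+1}}|^{p/i})^{i/p}`; only the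
levels `1, …, ⌊p⌋` of the two maps matter. -/
noncomputable def pVarDist {A : Type} [Fintype A] {T : ℝ} (p : ℝ)
    (X Y : Simplex T → TensorSeries A) : ℝ≥0∞ :=
  ⨆ i ∈ Finset.Icc 1 ⌊p⌋₊,
    (variation (p / (i : ℝ)) fun z => level (X z) i - level (Y z) i) ^ ((i : ℝ) / p)

/-! ### Signatures and geometric rough paths -/

/-- `S` is a Lyons extension of the `p`-rough path `X`: a multiplicative functional with values in
`T((ℝ^A))`, of finite `p`-variation, whose components of level at most `⌊p⌋` are those of `X`. -/
def IsLyonsExtension {A : Type} [Fintype A] {p T : ℝ} (X : RoughPath A p T)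
    (S : MultiplicativeFunctional A T ⊤) : Prop :=
  (∀ z w, w.length ≤ ⌊p⌋₊ → S.toFun z w = X.toFun z w) ∧ S.FinitePVar p

open Classical in
/-- The signature `X^{≤∞}` of a `p`-rough path: its Lyons extension. -/
noncomputable def signature {A : Type} [Fintype A] {p T : ℝ} (X : RoughPath A p T) :
    Simplex T → TensorSeries A :=
  if h : ∃ S : MultiplicativeFunctional A T ⊤, IsLyonsExtension X S then h.choose.toFun else 0

/-- A `p`-rough path is geometric if it is the limit, in the `p`-variation distance, of a sequence of
`1`-rough paths (each lifted to degree `⌊p⌋` by its own signature). -/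
def RoughPath.IsGeometric {A : Type} [Fintype A] {p T : ℝ} (X : RoughPath A p T) : Prop :=
  ∃ Y : ℕ → RoughPath A 1 T,
    Tendsto (fun k => pVarDist p (signature (Y k)) X.toFun) atTop (𝓝 0)

/-- The rough path lies over a time-extended path `X̂_t = (t, X_t)` in `ℝ^{d+1}`, the letter `0`
standing for the time component. -/
def RoughPath.IsTimeExtended {d : ℕ} {p T : ℝ} (X : RoughPath (Fin (d + 1)) p T) : Prop :=
  ∀ z : Simplex T, X.toFun z [0] = z.1.2 - z.1.1

/-! ### The p-variation topology -/

theorem level_sub_enorm_comm {A : Type} [Fintype A] (x y : TensorSeries A) (i : ℕ) :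
    ‖level x i - level y i‖ₑ = ‖level y i - level x i‖ₑ := by
  rw [← enorm_neg, neg_sub]

theorem pVarDist_self {A : Type} [Fintype A] {T : ℝ} (p : ℝ) (X : Simplex T → TensorSeries A) :
    pVarDist p X X = 0 := by
  simp only [pVarDist, ENNReal.iSup_eq_zero]
  intro i hi
  have hi := Finset.mem_Icc.1 hi
  have hi0 : (0 : ℝ) < i := by exact_mod_cast hi.1
  have hp : 0 < p := by
    have h : (1 : ℝ) ≤ p := (Nat.one_le_floor_iff p).1 (hi.1.trans hi.2)
    linarith
  have h0 : variation (p / (i : ℝ)) (fun z => level (X z) i - level (X z) i) = 0 := by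
    simp [variation, ENNReal.zero_rpow_of_pos (div_pos hp hi0)]
  rw [h0, ENNReal.zero_rpow_of_pos (div_pos hi0 hp)]

theorem pVarDist_comm {A : Type} [Fintype A] {T : ℝ} (p : ℝ) (X Y : Simplex T → TensorSeries A) :
    pVarDist p X Y = pVarDist p Y X := by
  simp only [pVarDist, variation, level_sub_enorm_comm]

theorem variation_rpow_add_le {T : ℝ} {E : Type} [NormedAddCommGroup E] {q : ℝ} (hq : 1 ≤ q)
    (Z W : Simplex T → E) :
    (variation q fun z => Z z + W z) ^ (1 / q) ≤ variation q Z ^ (1 / q) + variation q W ^ (1 / q) := by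
  have hq0 : 0 < q := by linarith
  rw [one_div, ENNReal.rpow_inv_le_iff hq0]
  refine iSup_le fun P => ?_
  rw [← ENNReal.rpow_inv_le_iff hq0]
  calc (∑ k ∈ Finset.range P.n, ‖Z (P.pair k) + W (P.pair k)‖ₑ ^ q) ^ q⁻¹
      ≤ (∑ k ∈ Finset.range P.n, (‖Z (P.pair k)‖ₑ + ‖W (P.pair k)‖ₑ) ^ q) ^ q⁻¹ := by
        refine ENNReal.rpow_le_rpow (Finset.sum_le_sum fun k _ => ?_) (by positivity)
        exact ENNReal.rpow_le_rpow (enorm_add_le _ _) hq0.le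
    _ ≤ (∑ k ∈ Finset.range P.n, ‖Z (P.pair k)‖ₑ ^ q) ^ q⁻¹ +
        (∑ k ∈ Finset.range P.n, ‖W (P.pair k)‖ₑ ^ q) ^ q⁻¹ := by
        simpa [one_div] using ENNReal.Lp_add_le (Finset.range P.n)
          (fun k => ‖Z (P.pair k)‖ₑ) (fun k => ‖W (P.pair k)‖ₑ) hq
    _ ≤ _ := by
        refine add_le_add ?_ ?_ <;> refine ENNReal.rpow_le_rpow ?_ (by positivity)
        · exact le_iSup (fun P : Partition T => ∑ k ∈ Finset.range P.n, ‖Z (P.pair k)‖ₑ ^ q) P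
        · exact le_iSup (fun P : Partition T => ∑ k ∈ Finset.range P.n, ‖W (P.pair k)‖ₑ ^ q) P

theorem pVarDist_triangle {A : Type} [Fintype A] {T : ℝ} (p : ℝ)
    (X Y Z : Simplex T → TensorSeries A) :
    pVarDist p X Z ≤ pVarDist p X Y + pVarDist p Y Z := by
  refine iSup₂_le fun i hi => ?_
  have hi' := Finset.mem_Icc.1 hi
  have hi0 : (0 : ℝ) < i := by exact_mod_cast hi'.1
  have hp : 1 ≤ p := (Nat.one_le_floor_iff p).1 (hi'.1.trans hi'.2)
  have hip : (i : ℝ) ≤ p := (Nat.le_floor_iff (by linarith)).1 hi'.2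
  have hq : 1 ≤ p / (i : ℝ) := (one_le_div hi0).2 hip
  have key := variation_rpow_add_le hq (fun z => level (X z) i - level (Y z) i)
    (fun z => level (Y z) i - level (Z z) i)
  simp only [sub_add_sub_cancel, one_div_div] at key
  refine key.trans (add_le_add ?_ ?_)
  · exact le_iSup₂ (f := fun (i : ℕ) (_ : i ∈ Finset.Icc 1 ⌊p⌋₊) =>
      (variation (p / (i : ℝ)) fun z => level (X z) i - level (Y z) i) ^ ((i : ℝ) / p)) i hi
  · exact le_iSup₂ (f := fun (i : ℕ) (_ : i ∈ Finset.Icc 1 ⌊p⌋₊) =>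
      (variation (p / (i : ℝ)) fun z => level (Y z) i - level (Z z) i) ^ ((i : ℝ) / p)) i hi

theorem eq_of_pVarDist_eq_zero {A : Type} [Fintype A] {p T : ℝ} (X Y : RoughPath A p T)
    (h : pVarDist p X.toFun Y.toFun = 0) : X = Y := by
  have key : X.toFun = Y.toFun := by
    funext z w
    by_cases hw : ⌊p⌋₊ < w.length
    · rw [X.trunc z w (by exact_mod_cast hw), Y.trunc z w (by exact_mod_cast hw)]
    rcases Nat.eq_zero_or_pos w.length with h0 | h0
    · rw [List.length_eq_zero_iff.1 h0, X.scalar, Y.scalar]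
    have hi : w.length ∈ Finset.Icc 1 ⌊p⌋₊ := Finset.mem_Icc.2 ⟨h0, not_lt.1 hw⟩
    have hi0 : (0 : ℝ) < w.length := by exact_mod_cast h0
    have hp : 0 < p := by
      have h1 : (1 : ℝ) ≤ p := (Nat.one_le_floor_iff p).1 (le_trans h0 (not_lt.1 hw))
      linarith
    simp only [pVarDist, ENNReal.iSup_eq_zero] at h
    have h1 := (ENNReal.rpow_eq_zero_iff_of_pos (div_pos hi0 hp)).1 (h _ hi)
    simp only [variation, ENNReal.iSup_eq_zero] at h1
    have h2 := h1 ⟨1, fun k => if k = 0 then z.1.1 else z.1.2,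
      monotone_nat_of_le_succ fun k => by
        by_cases hk : k = 0 <;> simp [hk, z.2.2.1],
      fun k => by
        by_cases hk : k = 0
        · simpa [hk] using ⟨z.2.1, z.2.2.1.trans z.2.2.2⟩
        · simpa [hk] using ⟨z.2.1.trans z.2.2.1, z.2.2.2⟩⟩
    simp only [Finset.sum_range_one, Partition.pair] at h2
    have h3 := (ENNReal.rpow_eq_zero_iff_of_pos (div_pos hp hi0)).1 h2
    rw [enorm_eq_zero, sub_eq_zero] at h3
    have h4 := congrArg (fun v => v w.get) h3
    simpa [level] using h4
  exact RoughPath.ext key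

/-- `p`-rough paths carry the `p`-variation distance and its topology. -/
noncomputable instance {A : Type} [Fintype A] {p T : ℝ} : EMetricSpace (RoughPath A p T) where
  edist X Y := pVarDist p X.toFun Y.toFun
  edist_self X := pVarDist_self p X.toFun
  edist_comm X Y := pVarDist_comm p X.toFun Y.toFun
  edist_triangle X Y Z := pVarDist_triangle p X.toFun Y.toFun Z.toFun
  eq_of_edist_eq_zero {X Y} h := eq_of_pVarDist_eq_zero X Y h

/-- The space of time-extended geometric `p`-rough paths over `ℝ^d`-valued paths on `[0, T]`, with
the `p`-variation topology. -/
abbrev TimeExtGeomRoughPath (d : ℕ) (p T : ℝ) : Type :=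
  {X : RoughPath (Fin (d + 1)) p T // X.IsTimeExtended ∧ X.IsGeometric}

/-- The terminal signature `X^{≤∞}_T = X^{≤∞}_{0,T}`. -/
noncomputable def terminalSignature {A : Type} [Fintype A] {p T : ℝ} (hT : 0 < T)
    (X : RoughPath A p T) : TensorSeries A :=
  signature X ⟨(0, T), le_rfl, hT.le, le_rfl⟩

end RoughSig

namespace RoughSig

/-! ### Deconcatenation and shuffles -/

theorem tensorMul_nil {A : Type} (x y : TensorSeries A) : tensorMul x y [] = x [] * y [] := by
  simp [tensorMul]

theorem tensorMul_cons {A : Type} (x y : TensorSeries A) (a : A) (w : List A) :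
    tensorMul x y (a :: w) = x [] * y (a :: w) + tensorMul (fun v => x (a :: v)) y w := by
  simp only [tensorMul, List.length_cons]
  rw [Finset.sum_range_succ', add_comm]
  simp

theorem tensorMul_add_left {A : Type} (x x' y : TensorSeries A) (w : List A) :
    tensorMul (fun v => x v + x' v) y w = tensorMul x y w + tensorMul x' y w := by
  simp [tensorMul, add_mul, Finset.sum_add_distrib]

theorem tensorMul_const_mul_left {A : Type} (c : ℝ) (x y : TensorSeries A) (w : List A) :
    tensorMul (fun v => c * x v) y w = c * tensorMul x y w := by
  simp [tensorMul, mul_assoc, Finset.mul_sum]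

theorem tensorMul_assoc {A : Type} (x y z : TensorSeries A) (w : List A) :
    tensorMul (tensorMul x y) z w = tensorMul x (tensorMul y z) w := by
  induction w generalizing x y with
  | nil => simp [tensorMul_nil, mul_assoc]
  | cons a w ih =>
    rw [tensorMul_cons, tensorMul_cons x, tensorMul_cons y]
    simp only [tensorMul_cons x y, tensorMul_nil]
    rw [tensorMul_add_left, tensorMul_const_mul_left, ih]
    ring

theorem tensorMul_congr {A : Type} {x x' y y' : TensorSeries A} {w : List A}
    (hx : ∀ v : List A, v.length ≤ w.length → x v = x' v)
    (hy : ∀ v : List A, v.length ≤ w.length → y v = y' v) :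
    tensorMul x y w = tensorMul x' y' w := by
  refine Finset.sum_congr rfl fun k _ => ?_
  rw [hx _ (by simp), hy _ (by simp)]

/-- The part of the tensor product in which both factors have positive degree. -/
def properMul {A : Type} (x y : TensorSeries A) (w : List A) : ℝ :=
  ∑ k ∈ Finset.Ico 1 w.length, x (w.take k) * y (w.drop k)

theorem tensorMul_eq_properMul {A : Type} (x y : TensorSeries A) {w : List A} (hw : w ≠ []) :
    tensorMul x y w = x [] * y w + properMul x y w + x w * y [] := by
  have h : 0 < w.length := List.length_pos_iff.2 hw
  rw [tensorMul, Finset.sum_range_succ, properMul, Finset.range_eq_Ico,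
    Finset.sum_eq_sum_Ico_succ_bot h]
  simp

theorem properMul_congr {A : Type} {x x' y y' : TensorSeries A} {w : List A}
    (hx : ∀ v : List A, v.length < w.length → x v = x' v)
    (hy : ∀ v : List A, v.length < w.length → y v = y' v) :
    properMul x y w = properMul x' y' w := by
  refine Finset.sum_congr rfl fun k hk => ?_
  have := Finset.mem_Ico.1 hk
  rw [hx _ (by simp; omega), hy _ (by simp; omega)]

/-- The cocycle identity for `properMul`, when `xy` and `yz` are the products up to lower degree. -/
theorem properMul_cocycle {A : Type} {x y z xy yz : TensorSeries A} {w : List A}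
    (hx : x [] = 1) (hz : z [] = 1) (hy : y [] = 1)
    (hxy : ∀ v : List A, v.length < w.length → xy v = tensorMul x y v)
    (hyz : ∀ v : List A, v.length < w.length → yz v = tensorMul y z v) :
    properMul x y w + properMul xy z w = properMul y z w + properMul x yz w := by
  rcases eq_or_ne w [] with rfl | hw
  · simp [properMul]
  have h := tensorMul_assoc x y z w
  rw [tensorMul_eq_properMul (tensorMul x y) _ hw, tensorMul_eq_properMul x (tensorMul y z) hw,
    tensorMul_eq_properMul x y hw, tensorMul_eq_properMul y z hw, tensorMul_nil, tensorMul_nil,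
    properMul_congr (fun v hv => (hxy v hv).symm) (fun v _ => rfl),
    properMul_congr (y := tensorMul y z) (fun v _ => rfl) (fun v hv => (hyz v hv).symm),
    hx, hy, hz] at h
  linarith

/-- The sum of the coordinates of `x` over all interleavings of two words, i.e. `⟨u ⧢ v, x⟩`. -/
def shuffleSum {A : Type} (x : TensorSeries A) (u v : List A) : ℝ := ((shuffles u v).map x).sum

@[simp] theorem shuffleSum_nil_left {A : Type} (x : TensorSeries A) (v : List A) :
    shuffleSum x [] v = x v := by
  simp [shuffleSum, shuffles]

@[simp] theorem shuffleSum_nil_right {A : Type} (x : TensorSeries A) (u : List A) :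
    shuffleSum x u [] = x u := by
  cases u <;> simp [shuffleSum, shuffles]

theorem shuffleSum_cons_cons {A : Type} (x : TensorSeries A) (a b : A) (u v : List A) :
    shuffleSum x (a :: u) (b :: v) =
      shuffleSum (fun w => x (a :: w)) u (b :: v) + shuffleSum (fun w => x (b :: w)) (a :: u) v := by
  simp [shuffleSum, shuffles, List.map_append, Function.comp_def]

theorem shuffleSum_add {A : Type} (x y : TensorSeries A) (u v : List A) :
    shuffleSum (fun w => x w + y w) u v = shuffleSum x u v + shuffleSum y u v := by
  simp [shuffleSum, List.sum_map_add]

theorem shuffleSum_const_mul {A : Type} (c : ℝ) (x : TensorSeries A) (u v : List A) :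
    shuffleSum (fun w => c * x w) u v = c * shuffleSum x u v := by
  simp [shuffleSum, List.sum_map_mul_left]

theorem length_of_mem_shuffles {A : Type} {u v w : List A} (h : w ∈ shuffles u v) :
    w.length = u.length + v.length := by
  induction u, v using shuffles.induct generalizing w with
  | case1 v => simp_all [shuffles]
  | case2 a u => simp_all [shuffles]
  | case3 a u b v ih₁ ih₂ =>
    simp only [shuffles, List.mem_append, List.mem_map] at h
    rcases h with ⟨w, hw, rfl⟩ | ⟨w, hw, rfl⟩
    · have := ih₁ hw
      simp at this ⊢; omega
    · have := ih₂ hw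
      simp at this ⊢; omega

theorem shuffleSum_congr {A : Type} {x y : TensorSeries A} {u v : List A}
    (h : ∀ w : List A, w.length = u.length + v.length → x w = y w) :
    shuffleSum x u v = shuffleSum y u v := by
  unfold shuffleSum
  congr 1
  exact List.map_congr_left fun w hw => h w (length_of_mem_shuffles hw)

theorem abs_shuffleSum_le {A : Type} {x : TensorSeries A} {u v : List A}
    {B : ℝ}
    (h : ∀ w : List A, w.length = u.length + v.length → |x w| ≤ B) :
    |shuffleSum x u v| ≤ (shuffles u v).length * B := by
  have : ∀ l : List (List A), (∀ w ∈ l, |x w| ≤ B) → |(l.map x).sum| ≤ l.length * B := by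
    intro l hl
    induction l with
    | nil => simp
    | cons w l ih =>
      have h1 := hl w (by simp)
      have h2 := ih fun w hw => hl w (by simp [hw])
      simp only [List.map_cons, List.sum_cons, List.length_cons, Nat.cast_add, Nat.cast_one]
      calc _ ≤ |x w| + |(l.map x).sum| := abs_add_le _ _
        _ ≤ _ := by linarith
  exact this _ fun w hw => h w (length_of_mem_shuffles hw)

theorem tendsto_shuffleSum {A ι : Type} {l : Filter ι} {x : ι → TensorSeries A}
    {y : TensorSeries A} {u v : List A} (h : ∀ w : List A, w.length = u.length + v.length →
      Tendsto (fun k => x k w) l (𝓝 (y w))) :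
    Tendsto (fun k => shuffleSum (x k) u v) l (𝓝 (shuffleSum y u v)) :=
  tendsto_list_sum _ fun w hw => h w (length_of_mem_shuffles hw)

/-- Deconcatenation is multiplicative for the shuffle product. -/
theorem shuffleSum_tensorMul {A : Type} (x y : TensorSeries A) (u v : List A) :
    shuffleSum (tensorMul x y) u v =
      ∑ i ∈ Finset.range (u.length + 1), ∑ j ∈ Finset.range (v.length + 1),
        shuffleSum x (u.take i) (v.take j) * shuffleSum y (u.drop i) (v.drop j) := by
  induction u, v using shuffles.induct generalizing x with
  | case1 v => simp [tensorMul]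
  | case2 a u => simp [tensorMul]
  | case3 a u b v ih₁ ih₂ =>
    rw [shuffleSum_cons_cons]
    simp only [tensorMul_cons]
    rw [shuffleSum_add, shuffleSum_add, shuffleSum_const_mul, shuffleSum_const_mul, ih₁, ih₂]
    simp only [List.length_cons]
    simp only [Finset.sum_range_succ' _ (v.length + 1), Finset.sum_range_succ' _ (u.length + 1),
      List.take_succ_cons, List.drop_succ_cons, List.take_zero, List.drop_zero,
      shuffleSum_cons_cons, shuffleSum_nil_left, shuffleSum_nil_right, add_mul,
      Finset.sum_add_distrib]
    ring

/-- If two tensor series satisfy the shuffle identity for pairs of words of total length less than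
`|u| + |v|`, then the defect of the shuffle identity at `(u, v)` is additive. -/
theorem shuffle_defect_tensorMul {A : Type} {x y : TensorSeries A} {u v : List A}
    (hx : x [] = 1) (hy : y [] = 1)
    (hxs : ∀ u' v' : List A, u'.length + v'.length < u.length + v.length →
      x u' * x v' = shuffleSum x u' v')
    (hys : ∀ u' v' : List A, u'.length + v'.length < u.length + v.length →
      y u' * y v' = shuffleSum y u' v')
    (huv : 0 < u.length + v.length) :
    tensorMul x y u * tensorMul x y v - shuffleSum (tensorMul x y) u v =
      (x u * x v - shuffleSum x u v) + (y u * y v - shuffleSum y u v) := by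
  rw [shuffleSum_tensorMul]
  simp only [tensorMul]
  rw [Finset.sum_mul_sum, ← Finset.sum_sub_distrib]
  simp only [← Finset.sum_sub_distrib, ← Finset.sum_product']
  have h0 : ((0, 0) : ℕ × ℕ) ≠ (u.length, v.length) := by
    intro h
    simp only [Prod.mk.injEq] at h
    omega
  rw [← Finset.sum_subset (s₁ := {(0, 0), (u.length, v.length)})]
  · rw [Finset.sum_pair h0]
    simp [hx, hy]
    ring
  · intro z hz
    simp only [Finset.mem_insert, Finset.mem_singleton] at hz
    rcases hz with rfl | rfl <;> simp
  · rintro ⟨i, j⟩ hz hz'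
    simp only [Finset.mem_product, Finset.mem_range, Finset.mem_insert, Finset.mem_singleton,
      Prod.mk.injEq, not_or] at hz hz'
    rw [← hxs _ _ (by simp; omega), ← hys _ _ (by simp; omega)]
    ring

/-! ### The pairing and shuffle products -/

theorem pairing_single {A : Type} (w : List A) (c : ℝ) (x : TensorSeries A) :
    pairing (Finsupp.single w c) x = c * x w := by
  simp [pairing]

theorem pairing_add {A : Type} (π ρ : WeightedWord A) (x : TensorSeries A) :
    pairing (π + ρ) x = pairing π x + pairing ρ x := by
  unfold pairing
  exact Finsupp.sum_add_index' (by simp) (by intros; ring)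

theorem pairing_smul {A : Type} (c : ℝ) (π : WeightedWord A) (x : TensorSeries A) :
    pairing (c • π) x = c * pairing π x := by
  unfold pairing
  rw [Finsupp.sum_smul_index (by simp), Finsupp.mul_sum]
  simp [mul_assoc]

theorem pairing_sum {A ι : Type} (s : Finset ι) (π : ι → WeightedWord A) (x : TensorSeries A) :
    pairing (∑ i ∈ s, π i) x = ∑ i ∈ s, pairing (π i) x := by
  classical
  induction s using Finset.induction_on with
  | empty => simp [pairing]
  | insert i s hi ih => rw [Finset.sum_insert hi, Finset.sum_insert hi, pairing_add, ih]

theorem pairing_shuffleWord {A : Type} (u v : List A) (x : TensorSeries A) :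
    pairing (shuffleWord u v) x = shuffleSum x u v := by
  unfold shuffleWord shuffleSum
  induction shuffles u v with
  | nil => simp [pairing]
  | cons w l ih => simp [pairing_add, pairing_single, ih]

/-- A tensor series is a character of the shuffle algebra. -/
def IsShuffleCharacter {A : Type} (x : TensorSeries A) : Prop :=
  x [] = 1 ∧ ∀ u v, x u * x v = shuffleSum x u v

theorem IsShuffleCharacter.pairing_shuffle {A : Type} {x : TensorSeries A}
    (hx : IsShuffleCharacter x) (π ρ : WeightedWord A) :
    pairing (shuffle π ρ) x = pairing π x * pairing ρ x := by
  unfold shuffle Finsupp.sum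
  rw [pairing_sum]
  simp only [pairing_sum, pairing_smul, pairing_shuffleWord, ← hx.2]
  simp only [pairing, Finsupp.sum, Finset.sum_mul_sum]
  refine Finset.sum_congr rfl fun u _ => Finset.sum_congr rfl fun v _ => by ring

theorem IsShuffleCharacter.pairing_shufflePow {A : Type} {x : TensorSeries A}
    (hx : IsShuffleCharacter x) (π : WeightedWord A) (k : ℕ) :
    pairing (shufflePow π k) x = pairing π x ^ k := by
  induction k with
  | zero => simp [shufflePow, pairing_single, hx.1]
  | succ k ih => rw [shufflePow, hx.pairing_shuffle, ih, pow_succ]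

theorem IsShuffleCharacter.pairing_shuffleMonomial {A : Type} {x : TensorSeries A}
    (hx : IsShuffleCharacter x) {n : ℕ} (π : Fin n → WeightedWord A) (m : Fin n → ℕ) :
    pairing (shuffleMonomial π m) x = ∏ i, pairing (π i) x ^ m i := by
  have h : ∀ l : List (WeightedWord A), pairing (l.foldr shuffle (Finsupp.single [] 1)) x =
      (l.map fun ρ => pairing ρ x).prod := by
    intro l
    induction l with
    | nil => simp [pairing_single, hx.1]
    | cons ρ l ih => simp [hx.pairing_shuffle, ih]
  rw [shuffleMonomial, h, List.map_ofFn, List.prod_ofFn]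
  simp [hx.pairing_shufflePow]

/-! ### Controls and the sewing lemma -/

/-- A control: a superadditive function of the subintervals of `[0, T]` that vanishes on short
intervals to the right and to the left of a point. -/
structure IsControl (T : ℝ) (ω : ℝ → ℝ → ℝ) : Prop where
  nonneg : ∀ s t, 0 ≤ s → s ≤ t → t ≤ T → 0 ≤ ω s t
  superadd : ∀ s u t, 0 ≤ s → s ≤ u → u ≤ t → t ≤ T → ω s u + ω u t ≤ ω s t
  right : ∀ x, 0 ≤ x → ∀ ε > 0, ∃ δ > 0, ∀ t, x ≤ t → t ≤ T → t < x + δ → ω x t < ε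
  left : ∀ x, x ≤ T → ∀ ε > 0, ∃ δ > 0, ∀ s, 0 ≤ s → s ≤ x → x < s + δ → ω s x < ε

namespace IsControl

variable {T : ℝ} {ω ω' : ℝ → ℝ → ℝ}

theorem self (h : IsControl T ω) {x : ℝ} (h0 : 0 ≤ x) (hT : x ≤ T) : ω x x = 0 := by
  have h1 := h.nonneg x x h0 le_rfl hT
  have h2 := h.superadd x x x h0 le_rfl le_rfl hT
  linarith

theorem mono (h : IsControl T ω) {s s' t' t : ℝ} (h0 : 0 ≤ s) (hs : s ≤ s') (hst : s' ≤ t')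
    (ht : t' ≤ t) (hT : t ≤ T) : ω s' t' ≤ ω s t := by
  have h1 := h.superadd s s' t h0 hs (hst.trans ht) hT
  have h2 := h.superadd s' t' t (h0.trans hs) hst ht hT
  have h3 := h.nonneg s s' h0 hs ((hst.trans ht).trans hT)
  have h4 := h.nonneg t' t ((h0.trans hs).trans hst) ht hT
  linarith

theorem add (h : IsControl T ω) (h' : IsControl T ω') :
    IsControl T fun s t => ω s t + ω' s t where
  nonneg s t h0 h1 h2 := add_nonneg (h.nonneg s t h0 h1 h2) (h'.nonneg s t h0 h1 h2)
  superadd s u t h0 h1 h2 h3 := by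
    have := h.superadd s u t h0 h1 h2 h3
    have := h'.superadd s u t h0 h1 h2 h3
    linarith
  right x hx ε hε := by
    obtain ⟨δ, hδ, H⟩ := h.right x hx (ε / 2) (half_pos hε)
    obtain ⟨δ', hδ', H'⟩ := h'.right x hx (ε / 2) (half_pos hε)
    refine ⟨min δ δ', lt_min hδ hδ', fun t h1 h2 h3 => ?_⟩
    have := H t h1 h2 (h3.trans_le (by simp))
    have := H' t h1 h2 (h3.trans_le (by simp))
    linarith
  left x hx ε hε := by
    obtain ⟨δ, hδ, H⟩ := h.left x hx (ε / 2) (half_pos hε)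
    obtain ⟨δ', hδ', H'⟩ := h'.left x hx (ε / 2) (half_pos hε)
    refine ⟨min δ δ', lt_min hδ hδ', fun t h1 h2 h3 => ?_⟩
    have := H t h1 h2 (h3.trans_le (by simp))
    have := H' t h1 h2 (h3.trans_le (by simp))
    linarith

end IsControl

/-- The constant of the sewing lemma. -/
noncomputable def sewingConst (C θ : ℝ) : ℝ := 2 * C / (1 - 2 ^ (1 - θ))

theorem two_rpow_one_sub_lt_one {θ : ℝ} (hθ : 1 < θ) : (2 : ℝ) ^ (1 - θ) < 1 :=
  Real.rpow_lt_one_of_one_lt_of_neg one_lt_two (by linarith)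

theorem sewingConst_nonneg {C θ : ℝ} (hC : 0 ≤ C) (hθ : 1 < θ) : 0 ≤ sewingConst C θ :=
  div_nonneg (by linarith) (by linarith [two_rpow_one_sub_lt_one hθ])

theorem sewingConst_eq {C θ : ℝ} (hθ : 1 < θ) :
    sewingConst C θ * 2 ^ (1 - θ) + 2 * C = sewingConst C θ := by
  have : 1 - (2 : ℝ) ^ (1 - θ) ≠ 0 := by linarith [two_rpow_one_sub_lt_one hθ]
  unfold sewingConst
  field_simp
  ring

/-- The germ `A` is almost additive: its defect is at most `C ω ^ θ`. -/
def AlmostAdditive (T : ℝ) (ω : ℝ → ℝ → ℝ) (C θ : ℝ) (A : ℝ → ℝ → ℝ) : Prop :=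
  ∀ s u t, 0 ≤ s → s ≤ u → u ≤ t → t ≤ T → |A s t - A s u - A u t| ≤ C * ω s t ^ θ

theorem AlmostAdditive.self {T C θ : ℝ} {ω A : ℝ → ℝ → ℝ} (hω : IsControl T ω) (hθ : 1 < θ)
    (hA : AlmostAdditive T ω C θ A) {x : ℝ} (h0 : 0 ≤ x) (hT : x ≤ T) : A x x = 0 := by
  have h := hA x x x h0 le_rfl le_rfl hT
  rw [hω.self h0 hT, Real.zero_rpow (by linarith), mul_zero] at h
  have h1 := abs_nonpos_iff.1 h
  linarith

theorem AlmostAdditive.sum_sub_le {T C θ : ℝ} {ω A : ℝ → ℝ → ℝ} (hω : IsControl T ω) (hθ : 1 < θ)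
    (hC : 0 ≤ C) (hA : AlmostAdditive T ω C θ A) {t : ℕ → ℝ} (ht : Monotone t)
    (htm : ∀ k, t k ∈ Set.Icc 0 T) (n a : ℕ) :
    |∑ i ∈ Finset.Ico a (a + n), A (t i) (t (i + 1)) - A (t a) (t (a + n))| ≤
      sewingConst C θ * ω (t a) (t (a + n)) ^ θ := by
  induction n using Nat.strong_induction_on generalizing a with
  | _ n ih =>
  have hC' := sewingConst_nonneg hC hθ
  rcases n with _ | n
  · simp only [add_zero, Finset.Ico_self, Finset.sum_empty,
      hA.self hω hθ (htm a).1 (htm a).2, sub_zero, abs_zero]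
    exact mul_nonneg hC' (Real.rpow_nonneg (hω.nonneg _ _ (htm a).1 le_rfl (htm a).2) _)
  classical
  set W := ω (t a) (t (a + (n + 1))) with hW
  have hW0 : 0 ≤ W := hω.nonneg _ _ (htm a).1 (ht (by omega)) (htm _).2
  let P : ℕ → Prop := fun j => ω (t a) (t (a + j)) ≤ W / 2
  have hP0 : P 0 := by
    simp only [P, add_zero, hω.self (htm a).1 (htm a).2]
    linarith
  set j := Nat.findGreatest P n with hj
  have hPj : P j := Nat.findGreatest_spec (Nat.zero_le n) hP0
  have hjn : j ≤ n := Nat.findGreatest_le n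
  obtain ⟨r, hr⟩ : ∃ r, n + 1 = j + 1 + r := ⟨n - j, by omega⟩
  have har : a + (n + 1) = a + j + 1 + r := by omega
  have hright : ω (t (a + j + 1)) (t (a + j + 1 + r)) ≤ W / 2 := by
    rcases hjn.eq_or_lt with h | h
    · have : r = 0 := by omega
      subst this
      rw [add_zero, hω.self (htm _).1 (htm _).2]
      linarith
    · have h1 : ¬ P (j + 1) := Nat.findGreatest_is_greatest (Nat.lt_succ_self _) h
      have h2 := hω.superadd (t a) (t (a + j + 1)) (t (a + j + 1 + r)) (htm a).1
        (ht (by omega)) (ht (by omega)) (htm _).2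
      rw [← har, ← hW] at h2
      simp only [P, not_le, ← add_assoc] at h1
      rw [← har]
      linarith
  have e1 := ih j (by omega) a
  have e2 := ih r (by omega) (a + j + 1)
  have e3 := hA (t a) (t (a + j)) (t (a + j + 1)) (htm a).1 (ht (by omega)) (ht (by omega))
    (htm _).2
  have e4 := hA (t a) (t (a + j + 1)) (t (a + j + 1 + r)) (htm a).1 (ht (by omega))
    (ht (by omega)) (htm _).2
  have hhalf : ∀ x, 0 ≤ x → x ≤ W / 2 → x ^ θ ≤ W ^ θ * 2 ^ (-θ) := by
    intro x hx hxW
    refine (Real.rpow_le_rpow hx hxW (by linarith)).trans_eq ?_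
    rw [Real.div_rpow hW0 zero_le_two, Real.rpow_neg zero_le_two, div_eq_mul_inv]
  have f1 := mul_le_mul_of_nonneg_left
    (hhalf _ (hω.nonneg _ _ (htm a).1 (ht (by omega)) (htm _).2) hPj) hC'
  have f2 := mul_le_mul_of_nonneg_left
    (hhalf _ (hω.nonneg _ _ (htm _).1 (ht (by omega)) (htm _).2) hright) hC'
  have f3 : C * ω (t a) (t (a + j + 1)) ^ θ ≤ C * W ^ θ := by
    refine mul_le_mul_of_nonneg_left (Real.rpow_le_rpow ?_ ?_ (by linarith)) hC
    · exact hω.nonneg _ _ (htm a).1 (ht (by omega)) (htm _).2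
    · exact hω.mono (htm a).1 le_rfl (ht (by omega)) (ht (by omega)) (htm _).2
  have hS : ∑ i ∈ Finset.Ico a (a + (n + 1)), A (t i) (t (i + 1)) =
      ∑ i ∈ Finset.Ico a (a + j), A (t i) (t (i + 1)) + A (t (a + j)) (t (a + j + 1)) +
        ∑ i ∈ Finset.Ico (a + j + 1) (a + j + 1 + r), A (t i) (t (i + 1)) := by
    rw [← Finset.sum_Ico_succ_top (by omega), Finset.sum_Ico_consecutive _ (by omega) (by omega),
      har]
  have key : sewingConst C θ * W ^ θ =
      sewingConst C θ * (W ^ θ * 2 ^ (-θ)) + sewingConst C θ * (W ^ θ * 2 ^ (-θ)) +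
        C * W ^ θ + C * W ^ θ := by
    have h2 : (2 : ℝ) ^ (1 - θ) = 2 * 2 ^ (-θ) := by
      rw [sub_eq_add_neg, Real.rpow_add two_pos, Real.rpow_one]
    have := sewingConst_eq (C := C) hθ
    rw [h2] at this
    calc sewingConst C θ * W ^ θ = (sewingConst C θ * (2 * 2 ^ (-θ)) + 2 * C) * W ^ θ := by
          rw [this]
      _ = _ := by ring
  rw [key, hS]
  rw [har] at hW ⊢
  rw [← hW] at e4
  rw [abs_le] at e1 e2 e3 e4 ⊢
  constructor <;> linarith [e1.1, e1.2, e2.1, e2.2, e3.1, e3.2, e4.1, e4.2]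

theorem AlmostAdditive.exists_sewing_finset {T C θ : ℝ} {ω A : ℝ → ℝ → ℝ} (hω : IsControl T ω)
    (hθ : 1 < θ) (hC : 0 ≤ C) (hT : 0 ≤ T) (hA : AlmostAdditive T ω C θ A) (D : Finset ℝ) :
    ∃ g : ℝ → ℝ, ∀ s ∈ D, ∀ t ∈ D, 0 ≤ s → s ≤ t → t ≤ T →
      |g t - g s - A s t| ≤ sewingConst C θ * ω s t ^ θ := by
  classical
  set E := D.filter (· ∈ Set.Icc 0 T) with hE
  let e := E.orderEmbOfFin rfl
  have hemem : ∀ k, e k ∈ Set.Icc 0 T := fun k =>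
    (Finset.mem_filter.1 (E.orderEmbOfFin_mem rfl k)).2
  let τ : ℕ → ℝ := fun k => if h : k < E.card then e ⟨k, h⟩ else T
  have hτm : ∀ k, τ k ∈ Set.Icc 0 T := by
    intro k
    by_cases h : k < E.card
    · simpa only [τ, h, dif_pos] using hemem ⟨k, h⟩
    · simpa [τ, h] using hT
  have hτ : Monotone τ := by
    intro i k hik
    by_cases h : k < E.card
    · have h' : i < E.card := hik.trans_lt h
      simp only [τ, h, h', dif_pos]
      exact e.monotone hik
    · have : τ k = T := by simp [τ, h]
      rw [this]
      exact (hτm i).2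
  have hidx : ∀ x ∈ E, ∃ k : Fin E.card, e k = x := by
    intro x hx
    have : x ∈ Set.range e := by
      rw [Finset.range_orderEmbOfFin]
      exact hx
    exact this
  choose κ hκ using hidx
  refine ⟨fun x => if hx : x ∈ E then
    ∑ i ∈ Finset.range (κ x hx), A (τ i) (τ (i + 1)) else 0, ?_⟩
  intro s hs t ht h0 hst hT'
  have hsE : s ∈ E := Finset.mem_filter.2 ⟨hs, h0, hst.trans hT'⟩
  have htE : t ∈ E := Finset.mem_filter.2 ⟨ht, h0.trans hst, hT'⟩
  have hle : κ s hsE ≤ κ t htE := by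
    rw [← e.le_iff_le, hκ, hκ]
    exact hst
  obtain ⟨n, hn⟩ := Nat.exists_eq_add_of_le (Fin.le_def.1 hle)
  have hτκ : ∀ x (hx : x ∈ E), τ (κ x hx) = x := by
    intro x hx
    simp [τ, hκ x hx]
  have key := hA.sum_sub_le hω hθ hC hτ hτm n (κ s hsE)
  rw [← hn, hτκ, hτκ, Finset.sum_Ico_eq_sub _ (Fin.le_def.1 hle)] at key
  simpa only [hsE, htE, dif_pos] using key

/-- The sewing lemma: an almost additive germ is close to the increments of a function. -/
theorem AlmostAdditive.exists_sewing {T C θ : ℝ} {ω A : ℝ → ℝ → ℝ} (hω : IsControl T ω)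
    (hθ : 1 < θ) (hC : 0 ≤ C) (hT : 0 ≤ T) (hA : AlmostAdditive T ω C θ A) :
    ∃ I : ℝ → ℝ, ∀ s t, 0 ≤ s → s ≤ t → t ≤ T →
      |I t - I s - A s t| ≤ sewingConst C θ * ω s t ^ θ := by
  classical
  choose g hg using hA.exists_sewing_finset hω hθ hC hT
  let U : Ultrafilter (Finset ℝ) := Ultrafilter.of atTop
  have hU : (U : Filter (Finset ℝ)) ≤ atTop := Ultrafilter.of_le _
  have hmem : ∀ x : ℝ, ∀ᶠ D in (U : Filter (Finset ℝ)), x ∈ D := fun x =>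
    hU ((eventually_ge_atTop {x}).mono fun D hD => hD (Finset.mem_singleton_self x))
  have hlim : ∀ t, 0 ≤ t → t ≤ T →
      ∃ l, Tendsto (fun D => g D t - g D 0) (U : Filter (Finset ℝ)) (𝓝 l) := by
    intro t h0 h1
    set R := |A 0 t| + sewingConst C θ * ω 0 t ^ θ
    have hb : ∀ᶠ D in (U : Filter (Finset ℝ)), g D t - g D 0 ∈ Set.Icc (-R) R := by
      filter_upwards [hmem 0, hmem t] with D hD0 hDt
      have := hg D 0 hD0 t hDt le_rfl h0 h1
      rw [Set.mem_Icc, ← abs_le]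
      calc |g D t - g D 0| = |(g D t - g D 0 - A 0 t) + A 0 t| := by ring_nf
        _ ≤ _ := abs_add_le _ _
        _ ≤ R := by simp only [R]; linarith
    obtain ⟨l, -, hl⟩ := (isCompact_Icc (a := -R) (b := R)).ultrafilter_le_nhds
      (U.map fun D => g D t - g D 0) (le_principal_iff.2 hb)
    exact ⟨l, hl⟩
  choose! I hI using hlim
  refine ⟨I, fun s t h0 hst h1 => ?_⟩
  have h2 := ((hI t (h0.trans hst) h1).sub (hI s h0 (hst.trans h1))).sub_const (A s t)
  refine le_of_tendsto h2.abs ?_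
  filter_upwards [hmem s, hmem t] with D hs ht
  simpa using hg D s hs t ht h0 hst h1

theorem eq_zero_of_additive_of_le {T θ K : ℝ} {ω D : ℝ → ℝ → ℝ} (hω : IsControl T ω) (hθ : 1 < θ)
    (hD : ∀ s u t, 0 ≤ s → s ≤ u → u ≤ t → t ≤ T → D s t = D s u + D u t)
    (hle : ∀ s t, 0 ≤ s → s ≤ t → t ≤ T → |D s t| ≤ K * ω s t ^ θ) :
    ∀ s t, 0 ≤ s → s ≤ t → t ≤ T → D s t = 0 := by
  have hsmall : ∀ η > 0, ∃ ε > 0, ∀ s t, 0 ≤ s → s ≤ t → t ≤ T → ω s t < ε →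
      |D s t| ≤ η * ω s t := by
    intro η hη
    have hc : Tendsto (fun x : ℝ => |K| * x ^ (θ - 1)) (𝓝 0) (𝓝 0) := by
      have := (Real.continuousAt_rpow_const 0 (θ - 1) (Or.inr (by linarith))).tendsto.const_mul |K|
      simpa [Real.zero_rpow (by linarith : θ - 1 ≠ 0)] using this
    obtain ⟨ε, hε, H⟩ := Metric.eventually_nhds_iff.1 (hc.eventually_lt_const hη)
    refine ⟨ε, hε, fun s t h0 hst h1 hlt => ?_⟩
    have hn := hω.nonneg s t h0 hst h1
    have h2 := H (y := ω s t) (by simpa [abs_of_nonneg hn] using hlt)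
    calc |D s t| ≤ K * ω s t ^ θ := hle s t h0 hst h1
      _ ≤ |K| * ω s t ^ θ := by gcongr; exact le_abs_self K
      _ = (|K| * ω s t ^ (θ - 1)) * ω s t := by
        conv_lhs => rw [show θ = (θ - 1) + 1 by ring, Real.rpow_add_one' hn (by linarith)]
        ring
      _ ≤ η * ω s t := by gcongr
  intro s t h0 hst h1
  have hbound : ∀ η > 0, |D s t| ≤ η * ω s t := by
    intro η hη
    obtain ⟨ε, hε, hsm⟩ := hsmall η hη
    have hloc : ∀ x : Set.Icc s t, ∃ δ > 0, ∀ r₁ r₂, s ≤ r₁ → r₁ ≤ r₂ → r₂ ≤ t →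
        x - δ < r₁ → r₂ < x + δ → |D r₁ r₂| ≤ η * ω r₁ r₂ := by
      rintro ⟨x, hx⟩
      obtain ⟨δ₁, hδ₁, H₁⟩ := hω.right x (h0.trans hx.1) ε hε
      obtain ⟨δ₂, hδ₂, H₂⟩ := hω.left x (hx.2.trans h1) ε hε
      refine ⟨min δ₁ δ₂, lt_min hδ₁ hδ₂, fun r₁ r₂ hr₁ hr hr₂ hd₁ hd₂ => ?_⟩
      have hd₁ : x < r₁ + δ₂ := by
        have : min δ₁ δ₂ ≤ δ₂ := min_le_right _ _
        simp only at hd₁; linarith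
      have hd₂ : r₂ < x + δ₁ := by
        have : min δ₁ δ₂ ≤ δ₁ := min_le_left _ _
        simp only at hd₂; linarith
      have hr₁0 : 0 ≤ r₁ := h0.trans hr₁
      have hr₂T : r₂ ≤ T := hr₂.trans h1
      have hxT : x ≤ T := hx.2.trans h1
      have hx0 : 0 ≤ x := h0.trans hx.1
      rcases le_total r₂ x with h | h
      · refine hsm _ _ hr₁0 hr hr₂T ((hω.mono hr₁0 le_rfl hr h hxT).trans_lt ?_)
        exact H₂ r₁ hr₁0 (hr.trans h) hd₁
      rcases le_total x r₁ with h' | h'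
      · refine hsm _ _ hr₁0 hr hr₂T ((hω.mono hx0 h' hr le_rfl hr₂T).trans_lt ?_)
        exact H₁ r₂ (h'.trans hr) hr₂T hd₂
      have a1 := hsm r₁ x hr₁0 h' hxT (H₂ r₁ hr₁0 h' hd₁)
      have a2 := hsm x r₂ hx0 h hr₂T (H₁ r₂ h hr₂T hd₂)
      rw [hD r₁ x r₂ hr₁0 h' h hr₂T]
      calc |D r₁ x + D x r₂| ≤ |D r₁ x| + |D x r₂| := abs_add_le _ _
        _ ≤ η * (ω r₁ x + ω x r₂) := by linarith
        _ ≤ _ := mul_le_mul_of_nonneg_left (hω.superadd _ _ _ hr₁0 h' h hr₂T) hη.le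
    choose δ hδ H using hloc
    obtain ⟨τ, hτ0, hτm, ⟨m, hm⟩, hτ⟩ := exists_monotone_Icc_subset_open_cover_Icc hst
      (c := fun x : Set.Icc s t => {y : Set.Icc s t | x - δ x < y ∧ (y : ℝ) < x + δ x})
      (fun x => (isOpen_lt continuous_const continuous_subtype_val).inter
        (isOpen_lt continuous_subtype_val continuous_const))
      (fun x _ => Set.mem_iUnion.2 ⟨x, by simp [hδ x]⟩)
    have hind : ∀ n, |D s (τ n)| ≤ η * ω s (τ n) := by
      intro n
      induction n with
      | zero =>
        have hself : D s s = 0 := by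
          have := hD s s s h0 le_rfl le_rfl (hst.trans h1)
          linarith
        rw [hτ0, hself, hω.self h0 (hst.trans h1)]
        simp
      | succ n ih =>
        have hm' : (τ n : ℝ) ≤ τ (n + 1) := hτm n.le_succ
        obtain ⟨x, hx⟩ := hτ n
        have b1 := hx (Set.left_mem_Icc.2 (hτm n.le_succ))
        have b2 := hx (Set.right_mem_Icc.2 (hτm n.le_succ))
        have b3 := H x (τ n) (τ (n + 1)) (τ n).2.1 hm' (τ (n + 1)).2.2 b1.1 b2.2
        have hT' : (τ (n + 1) : ℝ) ≤ T := (τ (n + 1)).2.2.trans h1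
        rw [hD s (τ n) (τ (n + 1)) h0 (τ n).2.1 hm' hT']
        calc _ ≤ |D s (τ n)| + |D (τ n) (τ (n + 1))| := abs_add_le _ _
          _ ≤ η * (ω s (τ n) + ω (τ n) (τ (n + 1))) := by linarith
          _ ≤ _ := mul_le_mul_of_nonneg_left
            (hω.superadd _ _ _ h0 (τ n).2.1 hm' hT') hη.le
    simpa [hm m le_rfl] using hind m
  have hlim : Tendsto (fun η : ℝ => η * ω s t) (𝓝[>] 0) (𝓝 0) := by
    have : Tendsto (fun η : ℝ => η * ω s t) (𝓝 0) (𝓝 (0 * ω s t)) := tendsto_id.mul_const _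
    rw [zero_mul] at this
    exact this.mono_left nhdsWithin_le_nhds
  have := ge_of_tendsto hlim (eventually_mem_nhdsWithin.mono fun η hη => hbound η hη)
  exact abs_nonpos_iff.1 this

/-! ### The control generated by a function of intervals -/

/-- The sum of `G` over the intervals of a partition. -/
def Partition.sum {T : ℝ} (P : Partition T) (G : ℝ → ℝ → ℝ) : ℝ :=
  ∑ k ∈ Finset.range P.n, G (P.pt k) (P.pt (k + 1))

/-- The partition of `[s, t]` with no interior point. -/
def Partition.single {T : ℝ} (s t : ℝ) (h0 : 0 ≤ s) (hst : s ≤ t) (hT : t ≤ T) : Partition T where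
  n := 1
  pt k := if k = 0 then s else t
  mono := monotone_nat_of_le_succ fun k => by by_cases hk : k = 0 <;> simp [hk, hst]
  mem k := by
    by_cases hk : k = 0
    · simpa [hk] using ⟨h0, hst.trans hT⟩
    · simpa [hk] using ⟨h0.trans hst, hT⟩

/-- Concatenation of partitions of two adjacent intervals. -/
def Partition.append {T : ℝ} (P Q : Partition T) (u : ℝ) (hP : ∀ k, P.pt k ≤ u)
    (hQ : ∀ k, u ≤ Q.pt k) : Partition T where
  n := P.n + (1 + Q.n)
  pt k := if k ≤ P.n then P.pt k else Q.pt (k - (P.n + 1))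
  mono := by
    intro i j hij
    by_cases hi : i ≤ P.n <;> by_cases hj : j ≤ P.n
    · simpa [hi, hj] using P.mono hij
    · simpa [hi, hj] using (hP _).trans (hQ _)
    · omega
    · simpa [hi, hj] using Q.mono (by omega)
  mem k := by
    by_cases hk : k ≤ P.n
    · simpa only [hk, if_true] using P.mem k
    · simpa only [hk, if_false] using Q.mem _

/-- Replace every point of a partition by its maximum with `u`. -/
def Partition.max {T : ℝ} (P : Partition T) (u : ℝ) (hu : u ≤ T) : Partition T where
  n := P.n
  pt k := Max.max (P.pt k) u
  mono := fun _ _ h => max_le_max_right _ (P.mono h)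
  mem k := ⟨(P.mem k).1.trans (le_max_left _ _), max_le (P.mem k).2 hu⟩

/-- Replace every point of a partition by its minimum with `u`. -/
def Partition.min {T : ℝ} (P : Partition T) (u : ℝ) (hu : 0 ≤ u) : Partition T where
  n := P.n
  pt k := Min.min (P.pt k) u
  mono := fun _ _ h => min_le_min_right _ (P.mono h)
  mem k := ⟨le_min (P.mem k).1 hu, (min_le_left _ _).trans (P.mem k).2⟩

/-- The supremum, over the partitions of `[s, t]`, of the sum of `G` over their intervals. -/
noncomputable def controlOf (T : ℝ) (G : ℝ → ℝ → ℝ) (s t : ℝ) : ℝ :=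
  ⨆ P : {P : Partition T // ∀ k, P.pt k ∈ Set.Icc s t}, P.1.sum G

section controlOf

variable {T V : ℝ} {G : ℝ → ℝ → ℝ}

theorem sum_le_controlOf (hV : ∀ P : Partition T, P.sum G ≤ V) {s t : ℝ} (P : Partition T)
    (hP : ∀ k, P.pt k ∈ Set.Icc s t) : P.sum G ≤ controlOf T G s t :=
  le_ciSup (f := fun P : {P : Partition T // ∀ k, P.pt k ∈ Set.Icc s t} => P.1.sum G)
    ⟨V, by rintro _ ⟨P, rfl⟩; exact hV P.1⟩ ⟨P, hP⟩

theorem le_controlOf (hV : ∀ P : Partition T, P.sum G ≤ V) {s t : ℝ} (h0 : 0 ≤ s) (hst : s ≤ t)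
    (hT : t ≤ T) : G s t ≤ controlOf T G s t := by
  have := sum_le_controlOf hV (s := s) (t := t) (Partition.single s t h0 hst hT) (fun k => by
    by_cases hk : k = 0 <;> simp [Partition.single, hk, hst])
  simpa [Partition.single, Partition.sum] using this

theorem nonempty_partition {s t : ℝ} (h0 : 0 ≤ s) (hst : s ≤ t) (hT : t ≤ T) :
    Nonempty {P : Partition T // ∀ k, P.pt k ∈ Set.Icc s t} :=
  ⟨⟨Partition.single s t h0 hst hT, fun k => by
    by_cases hk : k = 0 <;> simp [Partition.single, hk, hst]⟩⟩

theorem controlOf_le {B s t : ℝ} (h0 : 0 ≤ s) (hst : s ≤ t) (hT : t ≤ T)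
    (h : ∀ P : Partition T, (∀ k, P.pt k ∈ Set.Icc s t) → P.sum G ≤ B) :
    controlOf T G s t ≤ B :=
  haveI := nonempty_partition h0 hst hT
  ciSup_le fun P => h P.1 P.2

theorem controlOf_superadd (hG : ∀ s t, 0 ≤ s → s ≤ t → t ≤ T → 0 ≤ G s t)
    (hV : ∀ P : Partition T, P.sum G ≤ V) {s u t : ℝ} (h0 : 0 ≤ s) (hsu : s ≤ u) (hut : u ≤ t)
    (hT : t ≤ T) : controlOf T G s u + controlOf T G u t ≤ controlOf T G s t := by
  rw [← le_sub_iff_add_le]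
  refine controlOf_le h0 hsu (hut.trans hT) fun P hP => ?_
  rw [le_sub_iff_add_le, add_comm, ← le_sub_iff_add_le]
  refine controlOf_le (h0.trans hsu) hut hT fun Q hQ => ?_
  rw [le_sub_iff_add_le, add_comm]
  refine le_trans ?_ (sum_le_controlOf hV (P.append Q u (fun k => (hP k).2) fun k => (hQ k).1) ?_)
  · have e1 : (P.append Q u (fun k => (hP k).2) fun k => (hQ k).1).sum G =
        P.sum G + G (P.pt P.n) (Q.pt 0) + Q.sum G := by
      simp only [Partition.sum, Partition.append]
      rw [Finset.sum_range_add, Finset.sum_range_add, ← add_assoc]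
      congr 1
      · congr 1
        · refine Finset.sum_congr rfl fun k hk => ?_
          have := Finset.mem_range.1 hk
          rw [if_pos (by omega), if_pos (by omega)]
        · simp
      · refine Finset.sum_congr rfl fun k hk => ?_
        rw [if_neg (by omega), if_neg (by omega)]
        congr 2 <;> omega
    have e2 := hG (P.pt P.n) (Q.pt 0) (P.mem _).1 ((hP _).2.trans (hQ _).1) (Q.mem _).2
    rw [e1]
    linarith
  · intro k
    by_cases hk : k ≤ P.n
    · simpa only [Partition.append, hk, if_true] using ⟨(hP k).1, (hP k).2.trans hut⟩
    · simpa only [Partition.append, hk, if_false] using ⟨hsu.trans (hQ _).1, (hQ _).2⟩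

theorem isControl_controlOf (hG : ∀ s t, 0 ≤ s → s ≤ t → t ≤ T → 0 ≤ G s t)
    (hc : Continuous fun z : Simplex T => G z.1.1 z.1.2)
    (hV : ∀ P : Partition T, P.sum G ≤ V) : IsControl T (controlOf T G) where
  nonneg s t h0 hst h1 := (hG s t h0 hst h1).trans (le_controlOf hV h0 hst h1)
  superadd s u t h0 hsu hut h1 := controlOf_superadd hG hV h0 hsu hut h1
  right x hx ε hε := by
    by_cases hxT : x ≤ T
    swap
    · exact ⟨1, one_pos, fun t h1 h2 _ => absurd (h1.trans h2) hxT⟩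
    have := nonempty_partition hx hxT le_rfl
    obtain ⟨⟨P, hP⟩, hlt⟩ := exists_lt_of_lt_ciSup (sub_lt_self (controlOf T G x T) (half_pos hε))
    let S : Set.Icc (0 : ℝ) T → ℝ := fun u => (P.max u u.2.2).sum G
    have hS : Continuous S := by
      change Continuous fun u : Set.Icc (0 : ℝ) T => ∑ k ∈ Finset.range P.n,
        G ((P.max u u.2.2).pt k) ((P.max u u.2.2).pt (k + 1))
      refine continuous_finsetSum _ fun k _ => ?_
      have : Continuous fun u : Set.Icc (0 : ℝ) T => (P.max u u.2.2).pair k := by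
        refine Continuous.subtype_mk ?_ _
        simp only [Partition.max]
        fun_prop
      exact hc.comp this
    have hSx : S ⟨x, hx, hxT⟩ = P.sum G := by
      refine Finset.sum_congr rfl fun k _ => ?_
      simp only [Partition.max]
      rw [max_eq_left (hP k).1, max_eq_left (hP (k + 1)).1]
    have hev := hS.continuousAt.eventually_const_lt
      (show controlOf T G x T - ε < S ⟨x, hx, hxT⟩ by rw [hSx]; simp only at hlt; linarith)
    obtain ⟨δ, hδ, H⟩ := Metric.eventually_nhds_iff.1 hev
    refine ⟨δ, hδ, fun t h1 h2 h3 => ?_⟩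
    have h4 := H (y := ⟨t, hx.trans h1, h2⟩) (by
      rw [Subtype.dist_eq, Real.dist_eq, abs_of_nonneg (by simpa using h1)]
      simp only
      linarith)
    have h5 := sum_le_controlOf hV (s := t) (t := T) (P.max t h2) fun k =>
      ⟨le_max_right _ _, max_le (hP k).2 h2⟩
    have h6 := controlOf_superadd hG hV hx h1 h2 le_rfl
    simp only [S] at h4
    linarith
  left x hxT ε hε := by
    by_cases hx : 0 ≤ x
    swap
    · exact ⟨1, one_pos, fun t h1 h2 _ => absurd (h1.trans h2) hx⟩
    have := nonempty_partition le_rfl hx hxT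
    obtain ⟨⟨P, hP⟩, hlt⟩ := exists_lt_of_lt_ciSup (sub_lt_self (controlOf T G 0 x) (half_pos hε))
    let S : Set.Icc (0 : ℝ) T → ℝ := fun u => (P.min u u.2.1).sum G
    have hS : Continuous S := by
      change Continuous fun u : Set.Icc (0 : ℝ) T => ∑ k ∈ Finset.range P.n,
        G ((P.min u u.2.1).pt k) ((P.min u u.2.1).pt (k + 1))
      refine continuous_finsetSum _ fun k _ => ?_
      have : Continuous fun u : Set.Icc (0 : ℝ) T => (P.min u u.2.1).pair k := by
        refine Continuous.subtype_mk ?_ _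
        simp only [Partition.min]
        fun_prop
      exact hc.comp this
    have hSx : S ⟨x, hx, hxT⟩ = P.sum G := by
      refine Finset.sum_congr rfl fun k _ => ?_
      simp only [Partition.min]
      rw [min_eq_left (hP k).2, min_eq_left (hP (k + 1)).2]
    have hev := hS.continuousAt.eventually_const_lt
      (show controlOf T G 0 x - ε < S ⟨x, hx, hxT⟩ by rw [hSx]; simp only at hlt; linarith)
    obtain ⟨δ, hδ, H⟩ := Metric.eventually_nhds_iff.1 hev
    refine ⟨δ, hδ, fun t h1 h2 h3 => ?_⟩
    have h4 := H (y := ⟨t, h1, h2.trans hxT⟩) (by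
      rw [Subtype.dist_eq, Real.dist_eq, abs_of_nonpos (by simpa using h2)]
      simp only
      linarith)
    have h5 := sum_le_controlOf hV (s := 0) (t := t) (P.min t h1) fun k =>
      ⟨le_min (hP k).1 h1, min_le_right _ _⟩
    have h6 := controlOf_superadd hG hV le_rfl h1 h2 hxT
    simp only [S] at h4
    linarith

end controlOf

/-! ### Multiplicative functionals as functions of two real variables -/

/-- `x` is multiplicative and continuous up to degree `m`. -/
structure IsMultiplicative {A : Type} (T : ℝ) (m : ℕ) (x : ℝ → ℝ → TensorSeries A) : Prop where
  scalar : ∀ s t, 0 ≤ s → s ≤ t → t ≤ T → x s t [] = 1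
  cont : ∀ w : List A, w.length ≤ m → Continuous fun z : Simplex T => x z.1.1 z.1.2 w
  chen : ∀ s u t, 0 ≤ s → s ≤ u → u ≤ t → t ≤ T → ∀ w : List A, w.length ≤ m →
    x s t w = tensorMul (x s u) (x u t) w

/-- `x` is bounded by `M` times the powers of a control, up to degree `m`. -/
def IsControlled {A : Type} (T p : ℝ) (m : ℕ) (ω : ℝ → ℝ → ℝ) (M : ℝ)
    (x : ℝ → ℝ → TensorSeries A) : Prop :=
  ∀ s t, 0 ≤ s → s ≤ t → t ≤ T → ∀ w : List A, w.length ≤ m →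
    |x s t w| ≤ M * ω s t ^ ((w.length : ℝ) / p)

theorem IsControlled.mono {A : Type} {T p M M' : ℝ} {m : ℕ} {ω ω' : ℝ → ℝ → ℝ}
    {x : ℝ → ℝ → TensorSeries A} (h : IsControlled T p m ω M x) (hp : 0 < p) (hM : M ≤ M')
    (hM0 : 0 ≤ M) (hω : ∀ s t, 0 ≤ s → s ≤ t → t ≤ T → 0 ≤ ω s t ∧ ω s t ≤ ω' s t) :
    IsControlled T p m ω' M' x := by
  intro s t h0 h1 h2 w hw
  obtain ⟨h3, h4⟩ := hω s t h0 h1 h2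
  refine (h s t h0 h1 h2 w hw).trans ?_
  have h5 : 0 ≤ (w.length : ℝ) / p := by positivity
  exact mul_le_mul hM (Real.rpow_le_rpow h3 h4 h5) (Real.rpow_nonneg h3 _) (hM0.trans hM)

open Classical in
/-- A function on the simplex, extended by `0`. -/
noncomputable def extendSimplex {A : Type} {T : ℝ} (x : Simplex T → TensorSeries A) (s t : ℝ) :
    TensorSeries A :=
  if h : 0 ≤ s ∧ s ≤ t ∧ t ≤ T then x ⟨(s, t), h⟩ else 0

theorem extendSimplex_of_le {A : Type} {T : ℝ} (x : Simplex T → TensorSeries A) {s t : ℝ}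
    (h0 : 0 ≤ s) (h1 : s ≤ t) (h2 : t ≤ T) : extendSimplex x s t = x ⟨(s, t), h0, h1, h2⟩ := by
  simp [extendSimplex, h0, h1, h2]

theorem extendSimplex_coe {A : Type} {T : ℝ} (x : Simplex T → TensorSeries A) (z : Simplex T) :
    extendSimplex x z.1.1 z.1.2 = x z := extendSimplex_of_le x z.2.1 z.2.2.1 z.2.2.2

theorem MultiplicativeFunctional.isMultiplicative {A : Type} {T : ℝ} {N : ℕ∞}
    (X : MultiplicativeFunctional A T N) {m : ℕ} (hm : (m : ℕ∞) ≤ N) :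
    IsMultiplicative T m (extendSimplex X.toFun) where
  scalar s t h0 h1 h2 := by rw [extendSimplex_of_le _ h0 h1 h2, X.scalar]
  cont w _ := by simpa only [extendSimplex_coe] using X.cont w
  chen s u t h0 h1 h2 h3 w hw := by
    rw [extendSimplex_of_le _ h0 (h1.trans h2) h3, extendSimplex_of_le _ h0 h1 (h2.trans h3),
      extendSimplex_of_le _ (h0.trans h1) h2 h3]
    exact X.chen s u t h0 h1 h2 h3 w (le_trans (by exact_mod_cast hw) hm)

theorem abs_apply_le_norm_level {A : Type} [Fintype A] (x : TensorSeries A) (w : List A) :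
    |x w| ≤ ‖level x w.length‖ := by
  have := PiLp.norm_apply_le (level x w.length) w.get
  simpa [level] using this

theorem norm_level_le_sum {A : Type} [Fintype A] (x : TensorSeries A) (i : ℕ) :
    ‖level x i‖ ≤ ∑ v : Fin i → A, |x (List.ofFn v)| := by
  classical
  rw [EuclideanSpace.norm_eq]
  refine Real.sqrt_le_iff.2 ⟨Finset.sum_nonneg fun _ _ => abs_nonneg _, ?_⟩
  simpa [level] using Finset.sum_sq_le_sq_sum_of_nonneg (s := Finset.univ)
    (f := fun v : Fin i → A => |x (List.ofFn v)|) fun _ _ => abs_nonneg _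

theorem continuous_level {A : Type} [Fintype A] {Z : Type} [TopologicalSpace Z]
    {x : Z → TensorSeries A} (i : ℕ) (h : ∀ w : List A, Continuous fun z => x z w) :
    Continuous fun z => level (x z) i :=
  (PiLp.continuous_toLp 2 _).comp (continuous_pi fun v => h (List.ofFn v))

/-- The control of a multiplicative functional of finite `p`-variation. -/
theorem MultiplicativeFunctional.exists_control {A : Type} [Fintype A] {T p : ℝ} (hT : 0 ≤ T)
    (hp : 0 < p) {N : ℕ∞} (X : MultiplicativeFunctional A T N) (hX : X.FinitePVar p) {m : ℕ}
    (hm : (m : ℕ∞) ≤ N) :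
    ∃ ω, IsControl T ω ∧ IsControlled T p m ω 1 (extendSimplex X.toFun) ∧
      ω 0 T ≤ ∑ i ∈ Finset.Icc 1 m, (variation (p / i) fun z => level (X.toFun z) i).toReal := by
  let G : ℝ → ℝ → ℝ := fun s t =>
    ∑ i ∈ Finset.Icc 1 m, ‖level (extendSimplex X.toFun s t) i‖ ^ (p / i)
  have hG : ∀ s t, 0 ≤ G s t := fun s t =>
    Finset.sum_nonneg fun i _ => Real.rpow_nonneg (norm_nonneg _) _
  have hc : Continuous fun z : Simplex T => G z.1.1 z.1.2 := by
    refine continuous_finsetSum _ fun i hi => ?_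
    simp only [extendSimplex_coe]
    exact (continuous_level i X.cont).norm.rpow_const fun z => Or.inr (by positivity)
  have hV : ∀ P : Partition T, P.sum G ≤
      ∑ i ∈ Finset.Icc 1 m, (variation (p / i) fun z => level (X.toFun z) i).toReal := by
    intro P
    simp only [Partition.sum, G]
    rw [Finset.sum_comm]
    refine Finset.sum_le_sum fun i hi => ?_
    have hi := Finset.mem_Icc.1 hi
    have hfin := hX i hi.1 (le_trans (by exact_mod_cast hi.2) hm)
    have h1 : ∑ k ∈ Finset.range P.n, ‖level (X.toFun (P.pair k)) i‖ₑ ^ (p / i) ≤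
        variation (p / i) fun z => level (X.toFun z) i :=
      le_iSup (fun P : Partition T =>
        ∑ k ∈ Finset.range P.n, ‖level (X.toFun (P.pair k)) i‖ₑ ^ (p / i)) P
    have h2 := ENNReal.toReal_mono hfin.ne h1
    rw [ENNReal.toReal_sum fun k _ => (ENNReal.rpow_lt_top_of_nonneg (by positivity)
      enorm_ne_top).ne] at h2
    refine le_trans (le_of_eq (Finset.sum_congr rfl fun k _ => ?_)) h2
    rw [← ENNReal.toReal_rpow, toReal_enorm]
    exact congrArg (fun y => ‖level y i‖ ^ (p / i)) (extendSimplex_coe X.toFun (P.pair k))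
  refine ⟨controlOf T G, isControl_controlOf (fun s t _ _ _ => hG s t) hc hV, ?_,
    controlOf_le le_rfl hT le_rfl fun P _ => hV P⟩
  intro s t h0 h1 h2 w hw
  have hω := le_controlOf hV h0 h1 h2
  rcases Nat.eq_zero_or_pos w.length with hw0 | hw0
  · rw [List.length_eq_zero_iff.1 hw0, extendSimplex_of_le _ h0 h1 h2, X.scalar]
    simp
  have hw0' : (0 : ℝ) < w.length := by exact_mod_cast hw0
  have hle : ‖level (extendSimplex X.toFun s t) w.length‖ ^ (p / w.length) ≤ controlOf T G s t :=
    (Finset.single_le_sum (f := fun i : ℕ => ‖level (extendSimplex X.toFun s t) i‖ ^ (p / i))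
      (fun i _ => Real.rpow_nonneg (norm_nonneg _) _) (Finset.mem_Icc.2 ⟨hw0, hw⟩)).trans hω
  rw [one_mul]
  refine (abs_apply_le_norm_level _ _).trans ?_
  have := Real.rpow_le_rpow (Real.rpow_nonneg (norm_nonneg _) _) hle
    (show 0 ≤ (w.length : ℝ) / p by positivity)
  rwa [← Real.rpow_mul (norm_nonneg _), div_mul_div_cancel₀ hw0'.ne', div_self hp.ne',
    Real.rpow_one] at this

/-! ### Extension by one degree -/

theorem continuous_of_sewing {T K θ : ℝ} {ω A : ℝ → ℝ → ℝ} {I : ℝ → ℝ} (hω : IsControl T ω)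
    (hθ : 0 < θ) (hA : Continuous fun z : Simplex T => A z.1.1 z.1.2)
    (hA0 : ∀ x, 0 ≤ x → x ≤ T → A x x = 0)
    (hI : ∀ s t, 0 ≤ s → s ≤ t → t ≤ T → |I t - I s - A s t| ≤ K * ω s t ^ θ) :
    Continuous fun u : Set.Icc (0 : ℝ) T => I u := by
  rw [Metric.continuous_iff]
  rintro ⟨x, hx0, hxT⟩ ε hε
  obtain ⟨δ₁, hδ₁, H₁⟩ := Metric.continuous_iff.1 hA ⟨(x, x), hx0, le_rfl, hxT⟩ (ε / 2) (half_pos hε)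
  simp only [hA0 x hx0 hxT, Real.dist_eq, sub_zero] at H₁
  have hc : Tendsto (fun r : ℝ => K * r ^ θ) (𝓝 0) (𝓝 0) := by
    have := (Real.continuousAt_rpow_const 0 θ (Or.inr hθ.le)).tendsto.const_mul K
    simpa [Real.zero_rpow hθ.ne'] using this
  obtain ⟨η, hη, Hη⟩ := Metric.eventually_nhds_iff.1 (hc.eventually_lt_const (half_pos hε))
  have hsmall : ∀ s t, 0 ≤ s → s ≤ t → t ≤ T → ω s t < η → K * ω s t ^ θ < ε / 2 :=
    fun s t h0 h1 h2 h3 => Hη (by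
      rw [Real.dist_eq, sub_zero, abs_of_nonneg (hω.nonneg s t h0 h1 h2)]; exact h3)
  obtain ⟨δ₂, hδ₂, H₂⟩ := hω.right x hx0 η hη
  obtain ⟨δ₃, hδ₃, H₃⟩ := hω.left x hxT η hη
  refine ⟨min δ₁ (min δ₂ δ₃), lt_min hδ₁ (lt_min hδ₂ hδ₃), ?_⟩
  rintro ⟨y, hy0, hyT⟩ hd
  rw [Subtype.dist_eq, Real.dist_eq, lt_min_iff, lt_min_iff] at hd
  obtain ⟨hd₁, hd₂, hd₃⟩ := hd
  simp only at hd₁ hd₂ hd₃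
  rw [Real.dist_eq]
  rcases le_total x y with h | h
  · have h1 := H₁ ⟨(x, y), hx0, h, hyT⟩ (by
      simpa [Subtype.dist_eq, Prod.dist_eq, Real.dist_eq, hδ₁] using hd₁)
    have h2 := hsmall x y hx0 h hyT (H₂ y h hyT (by linarith [(abs_lt.1 hd₂).2]))
    have h3 := hI x y hx0 h hyT
    simp only at h1 ⊢
    rw [abs_lt] at h1 ⊢
    rw [abs_le] at h3
    constructor <;> linarith [h1.1, h1.2, h3.1, h3.2]
  · have h1 := H₁ ⟨(y, x), hy0, h, hxT⟩ (by
      simpa [Subtype.dist_eq, Prod.dist_eq, Real.dist_eq, hδ₁] using hd₁)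
    have h2 := hsmall y x hy0 h hxT (H₃ y hy0 h (by linarith [(abs_lt.1 hd₃).1]))
    have h3 := hI y x hy0 h hxT
    simp only at h1 ⊢
    rw [abs_lt] at h1 ⊢
    rw [abs_le] at h3
    constructor <;> linarith [h1.1, h1.2, h3.1, h3.2]

section step

variable {A : Type} {T p M : ℝ} {m : ℕ} {ω : ℝ → ℝ → ℝ} {x : ℝ → ℝ → TensorSeries A}

theorem abs_properMul_le (hp : 0 < p) (hM : 0 ≤ M) (hω : IsControl T ω)
    (hx : IsControlled T p m ω M x) {s u t : ℝ} (h0 : 0 ≤ s) (h1 : s ≤ u) (h2 : u ≤ t) (h3 : t ≤ T)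
    {w : List A} (hw : w.length = m + 1) :
    |properMul (x s u) (x u t) w| ≤ (m * M ^ 2) * ω s t ^ (((m + 1 : ℕ) : ℝ) / p) := by
  have hωst := hω.nonneg s t h0 (h1.trans h2) h3
  have hterm : ∀ k ∈ Finset.Ico 1 w.length, |x s u (w.take k) * x u t (w.drop k)| ≤
      M ^ 2 * ω s t ^ (((m + 1 : ℕ) : ℝ) / p) := by
    intro k hk
    have hk := Finset.mem_Ico.1 hk
    have l1 : (w.take k).length = k := by simp; omega
    have l2 : (w.drop k).length = m + 1 - k := by simp [hw]
    have b1 := hx s u h0 h1 (h2.trans h3) (w.take k) (by omega)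
    have b2 := hx u t (h0.trans h1) h2 h3 (w.drop k) (by omega)
    rw [l1] at b1
    rw [l2] at b2
    have c1 : ω s u ^ ((k : ℝ) / p) ≤ ω s t ^ ((k : ℝ) / p) :=
      Real.rpow_le_rpow (hω.nonneg s u h0 h1 (h2.trans h3)) (hω.mono h0 le_rfl h1 h2 h3)
        (by positivity)
    have c2 : ω u t ^ (((m + 1 - k : ℕ) : ℝ) / p) ≤ ω s t ^ (((m + 1 - k : ℕ) : ℝ) / p) :=
      Real.rpow_le_rpow (hω.nonneg u t (h0.trans h1) h2 h3) (hω.mono h0 h1 h2 le_rfl h3)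
        (by positivity)
    rw [abs_mul]
    calc _ ≤ (M * ω s t ^ ((k : ℝ) / p)) * (M * ω s t ^ (((m + 1 - k : ℕ) : ℝ) / p)) := by
          refine mul_le_mul (b1.trans (mul_le_mul_of_nonneg_left c1 hM))
            (b2.trans (mul_le_mul_of_nonneg_left c2 hM)) (abs_nonneg _) ?_
          exact mul_nonneg hM (Real.rpow_nonneg hωst _)
      _ = M ^ 2 * (ω s t ^ ((k : ℝ) / p) * ω s t ^ (((m + 1 - k : ℕ) : ℝ) / p)) := by ring
      _ = _ := by
        rw [← Real.rpow_add_of_nonneg hωst (by positivity) (by positivity), ← add_div,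
          ← Nat.cast_add, show k + (m + 1 - k) = m + 1 by omega]
  refine (Finset.abs_sum_le_sum_abs _ _).trans ((Finset.sum_le_sum hterm).trans_eq ?_)
  rw [Finset.sum_const, Nat.card_Ico, hw, nsmul_eq_mul]
  simp only [Nat.add_sub_cancel]
  ring

theorem properMul_chen (hx : IsMultiplicative T m x) {s u t : ℝ} (h0 : 0 ≤ s) (h1 : s ≤ u)
    (h2 : u ≤ t) (h3 : t ≤ T) {w : List A} (hw : w.length = m + 1) :
    properMul (x 0 s) (x s u) w + properMul (x 0 u) (x u t) w =
      properMul (x s u) (x u t) w + properMul (x 0 s) (x s t) w :=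
  properMul_cocycle (hx.scalar _ _ le_rfl h0 (h1.trans (h2.trans h3)))
    (hx.scalar _ _ (h0.trans h1) h2 h3) (hx.scalar _ _ h0 h1 (h2.trans h3))
    (fun v hv => hx.chen 0 s u le_rfl h0 h1 (h2.trans h3) v (by omega))
    (fun v hv => hx.chen s u t h0 h1 h2 h3 v (by omega))

theorem continuous_properMul (hx : IsMultiplicative T m x) {w : List A} (hw : w.length = m + 1) :
    Continuous fun z : Simplex T => properMul (x 0 z.1.1) (x z.1.1 z.1.2) w := by
  refine continuous_finsetSum _ fun k hk => ?_
  have hk := Finset.mem_Ico.1 hk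
  refine Continuous.mul ?_ (hx.cont _ (by simp; omega))
  exact (hx.cont (w.take k) (by simp; omega)).comp
    (g := fun z : Simplex T => x z.1.1 z.1.2 (w.take k))
    (f := fun z : Simplex T => (⟨(0, z.1.1), le_rfl, z.2.1, z.2.2.1.trans z.2.2.2⟩ : Simplex T))
    (Continuous.subtype_mk (by fun_prop) _)

/-- The bound at degree `m + 1` of the extension of a functional of degree `m` bounded by `M`. -/
noncomputable def stepConst (p : ℝ) (m : ℕ) (M : ℝ) : ℝ :=
  max M (sewingConst (m * M ^ 2) (((m + 1 : ℕ) : ℝ) / p))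

theorem exists_extension_succ (hT : 0 ≤ T) (hp : 0 < p) (hpm : p < m + 1) (hM : 0 ≤ M)
    (hω : IsControl T ω) (hx : IsMultiplicative T m x) (hxc : IsControlled T p m ω M x) :
    ∃ x' : ℝ → ℝ → TensorSeries A, IsMultiplicative T (m + 1) x' ∧
      IsControlled T p (m + 1) ω (stepConst p m M) x' ∧
      ∀ s t (w : List A), w.length ≤ m → x' s t w = x s t w := by
  have hθ : 1 < ((m + 1 : ℕ) : ℝ) / p := by
    rw [one_lt_div hp]
    exact_mod_cast hpm
  have hC : 0 ≤ m * M ^ 2 := by positivity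
  have haa : ∀ w : List A, w.length = m + 1 → AlmostAdditive T ω (m * M ^ 2)
      (((m + 1 : ℕ) : ℝ) / p) fun s t => properMul (x 0 s) (x s t) w := by
    intro w hw s u t h0 h1 h2 h3
    have h4 := properMul_chen hx h0 h1 h2 h3 hw
    rw [show properMul (x 0 s) (x s t) w - properMul (x 0 s) (x s u) w -
      properMul (x 0 u) (x u t) w = -properMul (x s u) (x u t) w by linarith, abs_neg]
    exact abs_properMul_le hp hM hω hxc h0 h1 h2 h3 hw
  have hI : ∀ w : List A, ∃ I : ℝ → ℝ, w.length = m + 1 → ∀ s t, 0 ≤ s → s ≤ t → t ≤ T →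
      |I t - I s - properMul (x 0 s) (x s t) w| ≤
        sewingConst (m * M ^ 2) (((m + 1 : ℕ) : ℝ) / p) * ω s t ^ (((m + 1 : ℕ) : ℝ) / p) := by
    intro w
    by_cases hw : w.length = m + 1
    · obtain ⟨I, hI⟩ := (haa w hw).exists_sewing hω hθ hC hT
      exact ⟨I, fun _ => hI⟩
    · exact ⟨0, fun h => absurd h hw⟩
  choose I hI using hI
  let x' : ℝ → ℝ → TensorSeries A := fun s t w =>
    if w.length = m + 1 then I w t - I w s - properMul (x 0 s) (x s t) w else x s t w
  have hlow : ∀ s t (w : List A), w.length ≤ m → x' s t w = x s t w := fun s t w hw =>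
    if_neg (by omega)
  have htop : ∀ s t (w : List A), w.length = m + 1 →
      x' s t w = I w t - I w s - properMul (x 0 s) (x s t) w := fun s t w hw => if_pos hw
  have hscalar : ∀ s t, 0 ≤ s → s ≤ t → t ≤ T → x' s t [] = 1 := fun s t h0 h1 h2 => by
    rw [hlow _ _ _ (Nat.zero_le _), hx.scalar s t h0 h1 h2]
  refine ⟨x', ⟨hscalar, ?_, ?_⟩, ?_, hlow⟩
  · intro w hw
    rcases hw.lt_or_eq with hw | hw
    · simpa only [hlow _ _ w (Nat.lt_succ_iff.1 hw)] using hx.cont w (Nat.lt_succ_iff.1 hw)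
    · simp only [htop _ _ w hw]
      have hcI := continuous_of_sewing hω (by linarith) (continuous_properMul hx hw)
        (fun y h0 h1 => (haa w hw).self hω hθ h0 h1) (hI w hw)
      refine Continuous.sub (Continuous.sub ?_ ?_) (continuous_properMul hx hw)
      · exact hcI.comp (f := fun z : Simplex T =>
          (⟨z.1.2, z.2.1.trans z.2.2.1, z.2.2.2⟩ : Set.Icc (0 : ℝ) T))
          (Continuous.subtype_mk (by fun_prop) _)
      · exact hcI.comp (f := fun z : Simplex T =>
          (⟨z.1.1, z.2.1, z.2.2.1.trans z.2.2.2⟩ : Set.Icc (0 : ℝ) T))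
          (Continuous.subtype_mk (by fun_prop) _)
  · intro s u t h0 h1 h2 h3 w hw
    rcases hw.lt_or_eq with hw | hw
    · rw [hlow _ _ w (by omega), hx.chen s u t h0 h1 h2 h3 w (by omega)]
      exact tensorMul_congr (fun v hv => (hlow _ _ v (by omega)).symm)
        fun v hv => (hlow _ _ v (by omega)).symm
    · have hne : w ≠ [] := by rintro rfl; simp at hw
      rw [tensorMul_eq_properMul _ _ hne, hscalar s u h0 h1 (h2.trans h3),
        hscalar u t (h0.trans h1) h2 h3, htop _ _ w hw, htop _ _ w hw, htop _ _ w hw,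
        properMul_congr (fun v hv => hlow s u v (by omega)) (fun v hv => hlow u t v (by omega))]
      have h4 := properMul_chen hx h0 h1 h2 h3 hw
      linarith
  · intro s t h0 h1 h2 w hw
    have hωst := hω.nonneg s t h0 h1 h2
    rcases hw.lt_or_eq with hw | hw
    · rw [hlow _ _ w (by omega)]
      refine (hxc s t h0 h1 h2 w (by omega)).trans ?_
      exact mul_le_mul_of_nonneg_right (le_max_left _ _) (Real.rpow_nonneg hωst _)
    · rw [htop _ _ w hw, hw]
      refine (hI w hw s t h0 h1 h2).trans ?_
      exact mul_le_mul_of_nonneg_right (le_max_right _ _) (Real.rpow_nonneg hωst _)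

/-- The bound at degree `N + k` of the extension of a functional of degree `N` bounded by `1`. -/
noncomputable def extensionConst (p : ℝ) (N : ℕ) : ℕ → ℝ
  | 0 => 1
  | k + 1 => stepConst p (N + k) (extensionConst p N k)

theorem one_le_extensionConst (p : ℝ) (N k : ℕ) : 1 ≤ extensionConst p N k := by
  induction k with
  | zero => exact le_rfl
  | succ k ih => exact ih.trans (le_max_left _ _)

theorem exists_extension {N : ℕ} (hT : 0 ≤ T) (hp : 0 < p) (hpN : p < N + 1) (hω : IsControl T ω)
    (hx : IsMultiplicative T N x) (hxc : IsControlled T p N ω 1 x) :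
    ∃ y : ℝ → ℝ → TensorSeries A, (∀ s t (w : List A), w.length ≤ N → y s t w = x s t w) ∧
      ∀ k, IsMultiplicative T (N + k) y ∧
        IsControlled T p (N + k) ω (extensionConst p N k) y := by
  let S : ℕ → Type := fun k => {y : ℝ → ℝ → TensorSeries A // IsMultiplicative T (N + k) y ∧
    IsControlled T p (N + k) ω (extensionConst p N k) y}
  have step : ∀ k (y : S k), ∃ y' : S (k + 1), ∀ s t (w : List A), w.length ≤ N + k →
      y'.1 s t w = y.1 s t w := by
    rintro k ⟨y, hy, hyc⟩
    obtain ⟨y', h1, h2, h3⟩ := exists_extension_succ hT hp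
      (by push_cast; linarith [(Nat.cast_nonneg k : (0 : ℝ) ≤ k)])
      (zero_le_one.trans (one_le_extensionConst p N k)) hω hy hyc
    exact ⟨⟨y', h1, h2⟩, h3⟩
  choose f hf using step
  let Y : ∀ k, S k := fun k => Nat.rec (motive := S) ⟨x, hx, hxc⟩ (fun k y => f k y) k
  have hY : ∀ k s t (w : List A), w.length ≤ N + k → (Y (k + 1)).1 s t w = (Y k).1 s t w :=
    fun k => hf k (Y k)
  have hY' : ∀ k l, k ≤ l → ∀ s t (w : List A), w.length ≤ N + k →
      (Y l).1 s t w = (Y k).1 s t w := by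
    intro k l hkl s t w hw
    induction l, hkl using Nat.le_induction with
    | base => rfl
    | succ l hl ih => exact (hY l s t w (by omega)).trans ih
  let y : ℝ → ℝ → TensorSeries A := fun s t w => (Y w.length).1 s t w
  have hy : ∀ k s t (w : List A), w.length ≤ N + k → y s t w = (Y k).1 s t w := by
    intro k s t w hw
    rcases le_total w.length k with h | h
    · exact (hY' _ _ h s t w (by omega)).symm
    · exact hY' _ _ h s t w hw
  refine ⟨y, fun s t w hw => hy 0 s t w hw, fun k => ⟨⟨?_, ?_, ?_⟩, ?_⟩⟩
  · intro s t h0 h1 h2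
    rw [hy 0 s t [] (Nat.zero_le _)]
    exact hx.scalar s t h0 h1 h2
  · intro w hw
    simpa only [hy k _ _ w hw] using (Y k).2.1.cont w hw
  · intro s u t h0 h1 h2 h3 w hw
    rw [hy k _ _ w hw, (Y k).2.1.chen s u t h0 h1 h2 h3 w hw]
    exact tensorMul_congr (fun v hv => (hy k _ _ v (hv.trans hw)).symm)
      fun v hv => (hy k _ _ v (hv.trans hw)).symm
  · intro s t h0 h1 h2 w hw
    rw [hy k _ _ w hw]
    exact (Y k).2.2 s t h0 h1 h2 w hw

end step

/-! ### Existence and uniqueness of the Lyons extension -/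

theorem IsControl.sum_le {T : ℝ} {ω : ℝ → ℝ → ℝ} (hω : IsControl T ω) (P : Partition T) (n : ℕ) :
    ∑ k ∈ Finset.range n, ω (P.pt k) (P.pt (k + 1)) ≤ ω (P.pt 0) (P.pt n) := by
  induction n with
  | zero => simpa using hω.nonneg _ _ (P.mem 0).1 le_rfl (P.mem 0).2
  | succ n ih =>
    rw [Finset.sum_range_succ]
    have := hω.superadd (P.pt 0) (P.pt n) (P.pt (n + 1)) (P.mem 0).1 (P.mono n.zero_le)
      (P.mono n.le_succ) (P.mem _).2
    linarith

theorem variation_lt_top_of_controlled {A : Type} [Fintype A] {T p M : ℝ} {ω : ℝ → ℝ → ℝ}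
    (hp : 0 < p) (hM : 0 ≤ M) (hω : IsControl T ω) {S : Simplex T → TensorSeries A} {i : ℕ}
    (hi : 1 ≤ i)
    (hS : ∀ z : Simplex T, ∀ w : List A, w.length = i →
      |S z w| ≤ M * ω z.1.1 z.1.2 ^ ((i : ℝ) / p)) :
    variation (p / i) (fun z => level (S z) i) < ⊤ := by
  have hi0 : (0 : ℝ) < i := by exact_mod_cast hi
  obtain ⟨c, hc⟩ : ∃ c : ℝ, c = ((Fintype.card (Fin i → A) : ℕ) : ℝ) := ⟨_, rfl⟩
  have hc0 : 0 ≤ c := hc ▸ Nat.cast_nonneg _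
  set K : ℝ := (c * M) ^ (p / i) with hK
  have hK0 : 0 ≤ K := Real.rpow_nonneg (mul_nonneg hc0 hM) _
  refine lt_of_le_of_lt (iSup_le fun P => ?_) (ENNReal.ofReal_lt_top (r := K * ω 0 T))
  have hterm : ∀ k, ‖level (S (P.pair k)) i‖ₑ ^ (p / i) ≤
      ENNReal.ofReal (K * ω (P.pt k) (P.pt (k + 1))) := by
    intro k
    have hωk : 0 ≤ ω (P.pt k) (P.pt (k + 1)) :=
      hω.nonneg _ _ (P.mem k).1 (P.mono k.le_succ) (P.mem _).2
    have h1 : ‖level (S (P.pair k)) i‖ ≤ c * M * ω (P.pt k) (P.pt (k + 1)) ^ ((i : ℝ) / p) := by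
      refine (norm_level_le_sum _ _).trans ?_
      refine (Finset.sum_le_sum fun v _ => hS (P.pair k) (List.ofFn v) (by simp)).trans_eq ?_
      rw [Finset.sum_const, nsmul_eq_mul, Finset.card_univ, mul_assoc, hc]
      rfl
    rw [← ofReal_norm, ENNReal.ofReal_rpow_of_nonneg (norm_nonneg _) (by positivity)]
    refine ENNReal.ofReal_le_ofReal ?_
    refine (Real.rpow_le_rpow (norm_nonneg _) h1 (by positivity)).trans_eq ?_
    rw [Real.mul_rpow (mul_nonneg hc0 hM) (Real.rpow_nonneg hωk _), ← Real.rpow_mul hωk,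
      div_mul_div_cancel₀ hp.ne', div_self hi0.ne', Real.rpow_one]
  refine (Finset.sum_le_sum fun k _ => hterm k).trans ?_
  rw [← ENNReal.ofReal_sum_of_nonneg fun k _ => mul_nonneg hK0
    (hω.nonneg _ _ (P.mem k).1 (P.mono k.le_succ) (P.mem _).2), ← Finset.mul_sum]
  refine ENNReal.ofReal_le_ofReal (mul_le_mul_of_nonneg_left ?_ hK0)
  exact (hω.sum_le P P.n).trans
    (hω.mono le_rfl (P.mem 0).1 (P.mono (Nat.zero_le _)) (P.mem _).2 le_rfl)

section extension

variable {A : Type} [Fintype A] {T p : ℝ} {ω : ℝ → ℝ → ℝ}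

theorem RoughPath.exists_isLyonsExtension (hT : 0 ≤ T) (hp : 0 < p) (X : RoughPath A p T)
    (hω : IsControl T ω) (hX : IsControlled T p ⌊p⌋₊ ω 1 (extendSimplex X.toFun)) :
    ∃ S : MultiplicativeFunctional A T ⊤, IsLyonsExtension X S ∧ ∀ k,
      IsControlled T p (⌊p⌋₊ + k) ω (extensionConst p ⌊p⌋₊ k) (extendSimplex S.toFun) := by
  obtain ⟨y, hyx, hy⟩ := exists_extension hT hp (Nat.lt_floor_add_one p) hω
    (X.isMultiplicative le_rfl) hX
  have hlen : ∀ w : List A, w.length ≤ ⌊p⌋₊ + w.length := fun w => Nat.le_add_left _ _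
  let S : MultiplicativeFunctional A T ⊤ :=
    { toFun := fun z => y z.1.1 z.1.2
      trunc := fun z w h => absurd h not_top_lt
      scalar := fun z => (hy 0).1.scalar _ _ z.2.1 z.2.2.1 z.2.2.2
      cont := fun w => (hy w.length).1.cont w (hlen w)
      chen := fun s u t hs hsu hut ht w _ => (hy w.length).1.chen s u t hs hsu hut ht w (hlen w) }
  refine ⟨S, ⟨fun z w hw => ?_, fun i hi _ => ?_⟩, fun k s t h0 h1 h2 w hw => ?_⟩
  · rw [← extendSimplex_coe X.toFun]
    exact hyx _ _ w hw
  · refine variation_lt_top_of_controlled hp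
      (zero_le_one.trans (one_le_extensionConst p ⌊p⌋₊ i)) hω hi fun z w hw => ?_
    have := (hy i).2 _ _ z.2.1 z.2.2.1 z.2.2.2 w (by omega)
    rwa [hw] at this
  · rw [extendSimplex_of_le _ h0 h1 h2]
    exact (hy k).2 s t h0 h1 h2 w hw

theorem one_lt_div_of_floor_lt (hp : 0 < p) {n : ℕ} (hn : ⌊p⌋₊ < n) : 1 < (n : ℝ) / p := by
  rw [one_lt_div hp]
  exact (Nat.floor_lt hp.le).1 hn

theorem IsLyonsExtension.unique (hT : 0 ≤ T) (hp : 0 < p) {X : RoughPath A p T}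
    {S₁ S₂ : MultiplicativeFunctional A T ⊤} (h₁ : IsLyonsExtension X S₁)
    (h₂ : IsLyonsExtension X S₂) : S₁.toFun = S₂.toFun := by
  have key : ∀ n, ∀ w : List A, w.length = n → ∀ s t, 0 ≤ s → s ≤ t → t ≤ T →
      extendSimplex S₁.toFun s t w = extendSimplex S₂.toFun s t w := by
    intro n
    induction n using Nat.strong_induction_on with
    | _ n ih =>
    intro w hw
    by_cases hn : n ≤ ⌊p⌋₊
    · intro s t h0 h1 h2
      rw [extendSimplex_of_le _ h0 h1 h2, extendSimplex_of_le _ h0 h1 h2,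
        h₁.1 _ w (hw.trans_le hn), h₂.1 _ w (hw.trans_le hn)]
    obtain ⟨ω₁, hω₁, hc₁, -⟩ := S₁.exists_control hT hp h₁.2 (m := n) le_top
    obtain ⟨ω₂, hω₂, hc₂, -⟩ := S₂.exists_control hT hp h₂.2 (m := n) le_top
    have hd₁ := hc₁.mono (ω' := fun s t => ω₁ s t + ω₂ s t) hp le_rfl zero_le_one
      fun s t h0 h1 h2 => ⟨hω₁.nonneg s t h0 h1 h2, by linarith [hω₂.nonneg s t h0 h1 h2]⟩
    have hd₂ := hc₂.mono (ω' := fun s t => ω₁ s t + ω₂ s t) hp le_rfl zero_le_one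
      fun s t h0 h1 h2 => ⟨hω₂.nonneg s t h0 h1 h2, by linarith [hω₁.nonneg s t h0 h1 h2]⟩
    have hne : w ≠ [] := by rintro rfl; simp at hw; omega
    have hm₁ := S₁.isMultiplicative (m := n) le_top
    have hm₂ := S₂.isMultiplicative (m := n) le_top
    have hzero := eq_zero_of_additive_of_le (hω₁.add hω₂)
      (one_lt_div_of_floor_lt hp (not_le.1 hn)) (K := 2)
      (D := fun s t => extendSimplex S₁.toFun s t w - extendSimplex S₂.toFun s t w) ?_ ?_
    · exact fun s t h0 h1 h2 => sub_eq_zero.1 (hzero s t h0 h1 h2)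
    · intro s u t h0 h1 h2 h3
      rw [hm₁.chen s u t h0 h1 h2 h3 w hw.le, hm₂.chen s u t h0 h1 h2 h3 w hw.le,
        tensorMul_eq_properMul _ _ hne, tensorMul_eq_properMul _ _ hne,
        hm₁.scalar s u h0 h1 (h2.trans h3), hm₁.scalar u t (h0.trans h1) h2 h3,
        hm₂.scalar s u h0 h1 (h2.trans h3), hm₂.scalar u t (h0.trans h1) h2 h3,
        properMul_congr
          (fun v hv => ih v.length (hw ▸ hv) v rfl s u h0 h1 (h2.trans h3))
          (fun v hv => ih v.length (hw ▸ hv) v rfl u t (h0.trans h1) h2 h3)]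
      ring
    · intro s t h0 h1 h2
      have b1 := hd₁ s t h0 h1 h2 w hw.le
      have b2 := hd₂ s t h0 h1 h2 w hw.le
      rw [hw] at b1 b2
      refine (abs_sub _ _).trans ?_
      linarith
  funext z w
  have := key _ w rfl _ _ z.2.1 z.2.2.1 z.2.2.2
  rwa [extendSimplex_coe, extendSimplex_coe] at this

theorem signature_eq_of_isLyonsExtension (hT : 0 ≤ T) (hp : 0 < p) {X : RoughPath A p T}
    {S : MultiplicativeFunctional A T ⊤} (hS : IsLyonsExtension X S) :
    signature X = S.toFun := by
  have h : ∃ S : MultiplicativeFunctional A T ⊤, IsLyonsExtension X S := ⟨S, hS⟩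
  rw [signature, dif_pos h]
  exact h.choose_spec.unique hT hp hS

theorem RoughPath.exists_signature_eq (hT : 0 ≤ T) (hp : 0 < p) (X : RoughPath A p T) :
    ∃ S : MultiplicativeFunctional A T ⊤, IsLyonsExtension X S ∧ signature X = S.toFun := by
  obtain ⟨ω, hω, hX, -⟩ := X.exists_control hT hp X.finitePVar le_rfl
  obtain ⟨S, hS, -⟩ := X.exists_isLyonsExtension hT hp hω hX
  exact ⟨S, hS, signature_eq_of_isLyonsExtension hT hp hS⟩

/-! ### The shuffle identity -/

/-- The shuffle identity propagates from the levels at most `⌊p⌋` to all levels. -/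
theorem MultiplicativeFunctional.shuffle_identity (hT : 0 ≤ T) (hp : 0 < p)
    (S : MultiplicativeFunctional A T ⊤) (hS : S.FinitePVar p)
    (hlow : ∀ z (u v : List A), u.length + v.length ≤ ⌊p⌋₊ →
      S.toFun z u * S.toFun z v = shuffleSum (S.toFun z) u v) (z : Simplex T) :
    IsShuffleCharacter (S.toFun z) := by
  have key : ∀ n, ∀ u v : List A, u.length + v.length = n → ∀ s t, 0 ≤ s → s ≤ t → t ≤ T →
      extendSimplex S.toFun s t u * extendSimplex S.toFun s t v -
        shuffleSum (extendSimplex S.toFun s t) u v = 0 := by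
    intro n
    induction n using Nat.strong_induction_on with
    | _ n ih =>
    intro u v huv
    by_cases hn : n ≤ ⌊p⌋₊
    · intro s t h0 h1 h2
      rw [extendSimplex_of_le _ h0 h1 h2, hlow _ u v (huv.trans_le hn), sub_self]
    obtain ⟨ω, hω, hc, -⟩ := S.exists_control hT hp hS (m := n) le_top
    have hm := S.isMultiplicative (m := n) le_top
    refine eq_zero_of_additive_of_le hω (one_lt_div_of_floor_lt hp (not_le.1 hn))
      (K := 1 + (shuffles u v).length) ?_ ?_
    · intro r s t h0 h1 h2 h3
      have hchen := hm.chen r s t h0 h1 h2 h3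
      rw [hchen u (by omega), hchen v (by omega),
        shuffleSum_congr fun w hw => hchen w (hw.trans huv).le]
      refine shuffle_defect_tensorMul (hm.scalar r s h0 h1 (h2.trans h3))
        (hm.scalar s t (h0.trans h1) h2 h3) (fun u' v' h => ?_) (fun u' v' h => ?_) (by omega)
      · exact sub_eq_zero.1 (ih _ (huv ▸ h) u' v' rfl r s h0 h1 (h2.trans h3))
      · exact sub_eq_zero.1 (ih _ (huv ▸ h) u' v' rfl s t (h0.trans h1) h2 h3)
    · intro s t h0 h1 h2
      have hωst := hω.nonneg s t h0 h1 h2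
      have b1 := hc s t h0 h1 h2 u (by omega)
      have b2 := hc s t h0 h1 h2 v (by omega)
      have b3 : |shuffleSum (extendSimplex S.toFun s t) u v| ≤
          (shuffles u v).length * ω s t ^ ((n : ℝ) / p) := abs_shuffleSum_le fun w hw => by
        have := hc s t h0 h1 h2 w (hw.trans huv).le
        rwa [hw, huv, one_mul] at this
      rw [one_mul] at b1 b2
      have b4 : |extendSimplex S.toFun s t u * extendSimplex S.toFun s t v| ≤
          ω s t ^ ((n : ℝ) / p) := by
        rw [abs_mul]
        refine (mul_le_mul b1 b2 (abs_nonneg _) (Real.rpow_nonneg hωst _)).trans_eq ?_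
        rw [← Real.rpow_add_of_nonneg hωst (by positivity) (by positivity), ← add_div,
          ← Nat.cast_add, huv]
      refine (abs_sub _ _).trans ?_
      linarith
  refine ⟨S.scalar z, fun u v => ?_⟩
  have := key _ u v rfl _ _ z.2.1 z.2.2.1 z.2.2.2
  rw [extendSimplex_coe] at this
  exact sub_eq_zero.1 this

theorem isShuffleCharacter_signature_one (hT : 0 ≤ T) (Y : RoughPath A 1 T) (z : Simplex T) :
    IsShuffleCharacter (signature Y z) := by
  obtain ⟨S, hS, h⟩ := Y.exists_signature_eq hT one_pos
  rw [h]
  refine S.shuffle_identity hT one_pos hS.2 (fun z u v huv => ?_) z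
  rw [Nat.floor_one] at huv
  rcases Nat.eq_zero_or_pos u.length with h0 | h0
  · simp [List.length_eq_zero_iff.1 h0, S.scalar]
  · have : v = [] := List.length_eq_zero_iff.1 (by omega)
    simp [this, S.scalar]

theorem enorm_sub_le_pVarDist (X Y : Simplex T → TensorSeries A) (z : Simplex T) {w : List A}
    (hw : 1 ≤ w.length) (hwp : w.length ≤ ⌊p⌋₊) : ‖X z w - Y z w‖ₑ ≤ pVarDist p X Y := by
  have hw0 : (0 : ℝ) < w.length := by exact_mod_cast hw
  have hp : 0 < p := by
    have : (1 : ℝ) ≤ p := (Nat.one_le_floor_iff p).1 (hw.trans hwp)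
    linarith
  have h1 : ‖X z w - Y z w‖ₑ ≤ ‖level (X z) w.length - level (Y z) w.length‖ₑ := by
    have := PiLp.enorm_apply_le (level (X z) w.length - level (Y z) w.length) w.get
    simpa [level] using this
  have h2 : ‖level (X z) w.length - level (Y z) w.length‖ₑ ^ (p / w.length) ≤
      variation (p / (w.length : ℝ)) fun z => level (X z) w.length - level (Y z) w.length := by
    refine le_trans (le_of_eq ?_) (le_iSup _ (Partition.single z.1.1 z.1.2 z.2.1 z.2.2.1 z.2.2.2))
    exact (Finset.sum_range_one (fun k => ‖level (X ((Partition.single z.1.1 z.1.2 z.2.1 z.2.2.1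
      z.2.2.2).pair k)) w.length - level (Y ((Partition.single z.1.1 z.1.2 z.2.1 z.2.2.1
      z.2.2.2).pair k)) w.length‖ₑ ^ (p / w.length))).symm
  refine h1.trans (le_trans ?_ (le_iSup₂ (f := fun (i : ℕ) (_ : i ∈ Finset.Icc 1 ⌊p⌋₊) =>
      (variation (p / (i : ℝ)) fun z => level (X z) i - level (Y z) i) ^ ((i : ℝ) / p))
      w.length (Finset.mem_Icc.2 ⟨hw, hwp⟩)))
  have h3 := ENNReal.rpow_le_rpow h2 (show 0 ≤ (w.length : ℝ) / p by positivity)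
  rwa [← ENNReal.rpow_mul, div_mul_div_cancel₀ hw0.ne', div_self hp.ne', ENNReal.rpow_one] at h3

/-- The signature of a geometric rough path is a character of the shuffle algebra. -/
theorem RoughPath.IsGeometric.isShuffleCharacter_signature (hT : 0 ≤ T) (hp : 0 < p)
    {X : RoughPath A p T} (hX : X.IsGeometric) (z : Simplex T) :
    IsShuffleCharacter (signature X z) := by
  obtain ⟨S, hS, h⟩ := X.exists_signature_eq hT hp
  rw [h]
  refine S.shuffle_identity hT hp hS.2 (fun z u v huv => ?_) z
  obtain ⟨Y, hY⟩ := hX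
  have hlim : ∀ w : List A, w.length ≤ ⌊p⌋₊ →
      Tendsto (fun k => signature (Y k) z w) atTop (𝓝 (S.toFun z w)) := by
    intro w hw
    rw [hS.1 z w hw]
    rcases Nat.eq_zero_or_pos w.length with h0 | h0
    · rw [List.length_eq_zero_iff.1 h0, X.scalar]
      simp only [(isShuffleCharacter_signature_one hT (Y _) z).1]
      exact tendsto_const_nhds
    · rw [tendsto_iff_edist_tendsto_0]
      refine tendsto_of_tendsto_of_tendsto_of_le_of_le tendsto_const_nhds hY
        (fun _ => zero_le) fun k => ?_
      rw [edist_eq_enorm_sub]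
      exact enorm_sub_le_pVarDist _ _ z h0 hw
  refine tendsto_nhds_unique ((hlim u (by omega)).mul (hlim v (by omega))) ?_
  simp only [(isShuffleCharacter_signature_one hT (Y _) z).2]
  exact tendsto_shuffleSum fun w hw => hlim w (by omega)

end extension

/-! ### Local boundedness of the terminal signature -/

theorem variation_le_of_pVarDist_le_one {A : Type} [Fintype A] {T p : ℝ} (hp : 0 < p)
    {X Y : Simplex T → TensorSeries A} (h : pVarDist p X Y ≤ 1) {i : ℕ}
    (hi : i ∈ Finset.Icc 1 ⌊p⌋₊) :
    variation (p / i) (fun z => level (X z) i) ≤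
      (1 + variation (p / i) (fun z => level (Y z) i) ^ ((i : ℝ) / p)) ^ (p / i) := by
  have hi' := Finset.mem_Icc.1 hi
  have hi0 : (0 : ℝ) < i := by exact_mod_cast hi'.1
  have hq : 1 ≤ p / (i : ℝ) := (one_le_div hi0).2 ((Nat.le_floor_iff hp.le).1 hi'.2)
  have key := variation_rpow_add_le hq (fun z => level (X z) i - level (Y z) i)
    (fun z => level (Y z) i)
  simp only [sub_add_cancel, one_div_div] at key
  have h1 : (variation (p / (i : ℝ)) fun z => level (X z) i - level (Y z) i) ^ ((i : ℝ) / p) ≤ 1 :=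
    (le_iSup₂ (f := fun (i : ℕ) (_ : i ∈ Finset.Icc 1 ⌊p⌋₊) =>
      (variation (p / (i : ℝ)) fun z => level (X z) i - level (Y z) i) ^ ((i : ℝ) / p)) i hi).trans h
  have h2 := ENNReal.rpow_le_rpow (key.trans (add_le_add_left h1 _))
    (show 0 ≤ p / (i : ℝ) by positivity)
  rwa [← ENNReal.rpow_mul, div_mul_div_cancel₀ hp.ne', div_self hi0.ne', ENNReal.rpow_one] at h2

theorem exists_bound_terminalSignature {A : Type} [Fintype A] {T p : ℝ} (hT : 0 < T) (hp : 0 < p)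
    (Y : RoughPath A p T) (w : List A) :
    ∃ B, ∀ X : RoughPath A p T, edist X Y ≤ 1 → |terminalSignature hT X w| ≤ B := by
  set V : ℕ → ℝ≥0∞ := fun i =>
    (1 + variation (p / i) (fun z => level (Y.toFun z) i) ^ ((i : ℝ) / p)) ^ (p / i) with hV
  have hVtop : ∀ i ∈ Finset.Icc 1 ⌊p⌋₊, V i ≠ ⊤ := by
    intro i hi
    have hi := Finset.mem_Icc.1 hi
    have hfin := Y.finitePVar i hi.1 (by exact_mod_cast hi.2)
    refine (ENNReal.rpow_lt_top_of_nonneg (by positivity) ?_).ne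
    exact ENNReal.add_ne_top.2 ⟨ENNReal.one_ne_top,
      (ENNReal.rpow_lt_top_of_nonneg (by positivity) hfin.ne).ne⟩
  refine ⟨extensionConst p ⌊p⌋₊ w.length *
    (∑ i ∈ Finset.Icc 1 ⌊p⌋₊, (V i).toReal) ^ ((w.length : ℝ) / p), fun X hXY => ?_⟩
  obtain ⟨ω, hω, hX, hωT⟩ := X.exists_control hT.le hp X.finitePVar le_rfl
  obtain ⟨S, hS, hSb⟩ := X.exists_isLyonsExtension hT.le hp hω hX
  have hb := hSb w.length 0 T le_rfl hT.le le_rfl w (by omega)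
  rw [extendSimplex_of_le _ le_rfl hT.le le_rfl] at hb
  rw [terminalSignature, signature_eq_of_isLyonsExtension hT.le hp hS]
  refine hb.trans (mul_le_mul_of_nonneg_left (Real.rpow_le_rpow
    (hω.nonneg 0 T le_rfl hT.le le_rfl) (hωT.trans (Finset.sum_le_sum fun i hi => ?_))
    (by positivity)) (zero_le_one.trans (one_le_extensionConst _ _ _)))
  exact ENNReal.toReal_mono (hVtop i hi) (variation_le_of_pVarDist_le_one hp hXY hi)

theorem abs_pairing_le {A : Type} (π : WeightedWord A) (x : TensorSeries A) :
    |pairing π x| ≤ ∑ w ∈ π.support, |π w| * |x w| := by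
  refine (Finset.abs_sum_le_sum_abs _ _).trans_eq ?_
  simp only [abs_mul]

theorem exists_bound_pairing {A : Type} [Fintype A] {T p : ℝ} (hT : 0 < T) (hp : 0 < p)
    {P : RoughPath A p T → Prop} {K : Set {X : RoughPath A p T // P X}} (hK : IsCompact K)
    (π : WeightedWord A) : ∃ B, ∀ X ∈ K, |pairing π (terminalSignature hT X.1)| ≤ B := by
  refine hK.induction_on (p := fun K => ∃ B, ∀ X ∈ K, |pairing π (terminalSignature hT X.1)| ≤ B)
    ⟨0, by simp⟩ (fun s t hst ⟨B, hB⟩ => ⟨B, fun X hX => hB X (hst hX)⟩) ?_ ?_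
  · rintro s t ⟨B, hB⟩ ⟨B', hB'⟩
    exact ⟨max B B', fun X hX => hX.elim (fun h => (hB X h).trans (le_max_left _ _))
      fun h => (hB' X h).trans (le_max_right _ _)⟩
  · intro Y _
    choose B hB using exists_bound_terminalSignature hT hp Y.1
    refine ⟨_, mem_nhdsWithin_of_mem_nhds (Metric.eball_mem_nhds Y one_pos),
      ∑ w ∈ π.support, |π w| * B w, fun X hX => ?_⟩
    refine (abs_pairing_le _ _).trans (Finset.sum_le_sum fun w _ => ?_)
    exact mul_le_mul_of_nonneg_left (hB w X.1 (le_of_lt hX)) (abs_nonneg _)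

/-! ### Polynomial approximation -/

/-- The multivariate Weierstrass approximation theorem on compact subsets of `ℝⁿ`. -/
theorem exists_monomial_sum_near {n : ℕ} {f : (Fin n → ℝ) → ℝ} (hf : Continuous f)
    {K : Set (Fin n → ℝ)} (hK : IsCompact K) {ε : ℝ} (hε : 0 < ε) :
    ∃ (N : Finset (Fin n → ℕ)) (α : (Fin n → ℕ) → ℝ), ∀ y ∈ K,
      |f y - ∑ m ∈ N, α m * ∏ i, y i ^ m i| < ε := by
  let c : Fin n → C(Fin n → ℝ, ℝ) := fun i => ⟨fun y => y i, continuous_apply i⟩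
  let P : MvPolynomial (Fin n) ℝ →ₐ[ℝ] C(Fin n → ℝ, ℝ) := MvPolynomial.aeval c
  have hsep : P.range.SeparatesPoints := by
    intro x y hxy
    obtain ⟨i, hi⟩ := Function.ne_iff.1 hxy
    exact ⟨c i, ⟨c i, ⟨MvPolynomial.X i, by simp [P]⟩, rfl⟩, hi⟩
  obtain ⟨_, ⟨q, rfl⟩, hq⟩ :=
    ContinuousMap.exists_mem_subalgebra_near_continuous_of_isCompact_of_separatesPoints hsep
      ⟨f, hf⟩ hK hε
  have heval : ∀ y, P q y = ∑ m ∈ q.support, q.coeff m * ∏ i, y i ^ m i := by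
    intro y
    rw [← MvPolynomial.eval_eq']
    clear hq
    induction q using MvPolynomial.induction_on with
    | C a => simp [P]
    | add p q hp hq => simp_all
    | mul_X p i hp =>
      rw [map_mul, map_mul, ContinuousMap.mul_apply, hp]
      simp [P, c]
  refine ⟨q.support.map Finsupp.equivFunOnFinite.toEmbedding,
    fun m => q.coeff (Finsupp.equivFunOnFinite.symm m), fun y hy => ?_⟩
  have := hq y hy
  rw [Real.norm_eq_abs, abs_sub_comm] at this
  change |f y - P q y| < ε at this
  rw [heval] at this
  simpa using this

end RoughSig

theorem mainTheorem5 (d : ℕ) (p T : ℝ) (hp : 1 ≤ p) (hT : 0 < T)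
    (F : RoughSig.TimeExtGeomRoughPath d p T → ℝ) (hF : Continuous F)
    (n : ℕ) (π : Fin n → RoughSig.WeightedWord (Fin (d + 1)))
    (f : (Fin n → ℝ) → ℝ) (hf : Continuous f)
    (hFf : ∀ X : RoughSig.TimeExtGeomRoughPath d p T,
      F X = f fun i => RoughSig.pairing (π i) (RoughSig.terminalSignature hT X.1)) :
    (∀ (m : Fin n → ℕ) (X : RoughSig.TimeExtGeomRoughPath d p T),
      ∏ i, RoughSig.pairing (π i) (RoughSig.terminalSignature hT X.1) ^ m i =
        RoughSig.pairing (RoughSig.shuffleMonomial π m) (RoughSig.terminalSignature hT X.1)) ∧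
    ∀ ε : ℝ, 0 < ε → ∀ K : Set (RoughSig.TimeExtGeomRoughPath d p T), IsCompact K →
      ∃ (N : Finset (Fin n → ℕ)) (α : (Fin n → ℕ) → ℝ), ∀ X ∈ K,
        |F X - ∑ m ∈ N, α m * RoughSig.pairing (RoughSig.shuffleMonomial π m)
          (RoughSig.terminalSignature hT X.1)| < ε := by
  have hp0 : 0 < p := by linarith
  have hmono : ∀ (m : Fin n → ℕ) (X : RoughSig.TimeExtGeomRoughPath d p T),
      ∏ i, RoughSig.pairing (π i) (RoughSig.terminalSignature hT X.1) ^ m i =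
        RoughSig.pairing (RoughSig.shuffleMonomial π m) (RoughSig.terminalSignature hT X.1) :=
    fun m X => ((X.2.2.isShuffleCharacter_signature hT.le hp0 _).pairing_shuffleMonomial π m).symm
  refine ⟨hmono, fun ε hε K hK => ?_⟩
  choose B hB using fun i => RoughSig.exists_bound_pairing hT hp0 hK (π i)
  obtain ⟨N, α, h⟩ := RoughSig.exists_monomial_sum_near hf
    (isCompact_univ_pi fun i => isCompact_Icc (a := -B i) (b := B i)) hε
  refine ⟨N, α, fun X hX => ?_⟩
  have := h (fun i => RoughSig.pairing (π i) (RoughSig.terminalSignature hT X.1))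
    fun i _ => abs_le.1 (hB i X hX)
  simpa only [hFf, hmono] using this
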